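/- **Setting.** Let $\sigma:\mathbb R\to\mathbb R$ be Lipschitz, and let $n_0\ge 1$, $k\ge 0$ and inputs $\mathcal X=(x_1,\dots,x_k)$ in $\mathbb R^{n_0}$ be given. For $L\ge 1$, layer sizes $n_1,\dots,n_L\ge 1$ and variances $c_w^{(\ell)},c_b^{(\ell)}\ge 0$ ($0\le \ell<L$), let $W^{(\ell)}\in\mathbb R^{n_{\ell+1}\times n_\ell}$ and $b^{(\ell)}\in\mathbb R^{n_{\ell+1}}$, $0\le\ell<L$, have entries that are all independent centred Gaussian random variables with $\operatorname{Var}W^{(\ell)}_{i,j}=c_w^{(\ell)}/n_\ell$ and $\operatorname{Var}b^{(\ell)}_i=c_b^{(\ell)}$. Put $$f^{(1)}[x]=W^{(0)}x+b^{(0)},\qquad f^{(\ell)}[x]=W^{(\ell-1)}\sigma(f^{(\ell-1)}[x])+b^{(\ell-1)}\quad(2\le \ell\le L),$$ with $\sigma$ applied componentwise, and $f^{(\ell)}[\mathcal X]=(f^{(\ell)}[x_a])_{a=1}^k\in\mathbb R^{n_\ell\times k}$. Define kernels on $\mathbb R^{n_0}$ by $$K^{(1)}[x,y]=\frac{c_w^{(0)}}{n_0}\langle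 x,y\rangle+c_b^{(0)},\qquad K^{(\ell)}[x,y]=c_w^{(\ell-1)}\,\mathbb E\big[\sigma(g_x)\sigma(g_y)\big]+c_b^{(\ell-1)}\quad(\ell\ge 2),$$ where $(g_x,g_y)$ is centred Gaussian whose covariance is the restriction of $K^{(\ell-1)}$ to the two points $x,y$. Let $G^{(\ell)}[\mathcal X]$ be the centred Gaussian in $\mathbb R^{n_\ell\times k}$ with covariance $\mathrm{Id}_{n_\ell}\otimes K^{(\ell)}[\mathcal X]$, where $K^{(\ell)}[\mathcal X]=(K^{(\ell)}[x_a,x_{a'}])_{a,a'}$; that is, $n_\ell$ independent copies of $\mathcal N(K^{(\ell)}[\mathcal X])$. For laws $p,q$, let $\mathcal W_2(p,q)=\inf\big(\int\|x-y\|^2\,d\pi(x,y)\big)^{1/2}$ over all couplings $\pi$ of $p$ and $q$, with the Euclidean (Frobenius) norm; for random variables, $\mathcal W_2$ is taken between their laws. **Theorem.** 1. There are constants $C^{(\ell)}\in(0,\infty)$, $\ell\ge1$, where $C^{(\ell)}$ depends only on $\sigma$, $\mathcal X$ and $(c_w^{(i)},c_b^{(i)})_{i=0}^{\ell-1}$,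 such that, for all $L$, all layer sizes, every Lipschitz constant $\operatorname{Lip}(\sigma)$ of $\sigma$ and every $1\le \ell\le L$, $$\mathcal W_2\big(f^{(\ell)}[\mathcal X],G^{(\ell)}[\mathcal X]\big)\le\sqrt{n_\ell}\,\sum_{i=1}^{\ell-1}\frac{C^{(i+1)}\operatorname{Lip}(\sigma)^{\ell-i-1}\sqrt{\prod_{j=i+1}^{\ell-1}c_w^{(j)}}}{\sqrt{n_i}}.$$ 2. In particular, for every $L\ge1$ there is $C\in(0,\infty)$, depending only on $\sigma$, $\mathcal X$, $L$ and $(c_w^{(i)},c_b^{(i)})_{i=0}^{L-1}$, such that for all layer sizes $n_1,\dots,n_L$ $$\mathcal W_2\big(f^{(L)}[\mathcal X],G^{(L)}[\mathcal X]\big)\le C\sqrt{n_L}\,\sum_{\ell=1}^{L-1}\frac1{\sqrt{n_\ell}}.$$ 3. Hence the network converges to the Gaussian process in the wide limit: with $\sigma$, $\mathcal X$, $L$, the variances and $n_L$ fixed, for every $\varepsilon>0$ there is $N$ such that $\mathcal W_2\big(f^{(L)}[\mathcal X],G^{(L)}[\mathcal X]\big)<\varepsilon$ whenever $n_1,\dots,n_{L-1}\ge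 N$. -/

import Mathlib

open MeasureTheory ProbabilityTheory Matrix
open scoped NNReal ENNReal Kronecker

noncomputable section

/-- The quadratic Wasserstein distance of two measures on `E`: the infimum of
`(∫ ‖x - y‖² dπ(x, y)) ^ (1/2)` over all couplings `π` of `p` and `q`. -/
def wasserstein2 {E : Type*} [NormedAddCommGroup E] [MeasurableSpace E] (p q : Measure E) : ℝ≥0∞ :=
  ⨅ π ∈ {π : Measure (E × E) | π.map Prod.fst = p ∧ π.map Prod.snd = q},
    (∫⁻ z, ‖z.1 - z.2‖ₑ ^ 2 ∂π) ^ (1 / 2 : ℝ)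

/-- Layer sizes of a network: the input layer has size `n₀`, layer `ℓ ≥ 1` has size `n ℓ`
(the value `n 0` is not used). -/
def layerSize (n₀ : ℕ) (n : ℕ → ℕ) : ℕ → ℕ
  | 0 => n₀
  | ℓ + 1 => n (ℓ + 1)

/-- Output at layer `ℓ ≥ 1` of the fully connected network with layer sizes `n`, activation
function `σ` (applied componentwise), weights `W` and biases `b`, at the input `x`:
`f⁽¹⁾ = W⁽⁰⁾ x + b⁽⁰⁾` and `f⁽ˡ⁾ = W⁽ˡ⁻¹⁾ σ(f⁽ˡ⁻¹⁾) + b⁽ˡ⁻¹⁾` for `ℓ ≥ 2`.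
Layer `0` is the input itself. -/
def networkOutput (σ : ℝ → ℝ) {n : ℕ → ℕ}
    (W : (ℓ : ℕ) → Matrix (Fin (n (ℓ + 1))) (Fin (n ℓ)) ℝ)
    (b : (ℓ : ℕ) → Fin (n (ℓ + 1)) → ℝ) (x : Fin (n 0) → ℝ) : (ℓ : ℕ) → Fin (n ℓ) → ℝ
  | 0 => x
  | 1 => W 0 *ᵥ x + b 0
  | ℓ + 2 => W (ℓ + 1) *ᵥ (fun i => σ (networkOutput σ W b x (ℓ + 1) i)) + b (ℓ + 1)

/-- The outputs of layer `ℓ` at the `k` inputs `X`, as an `n ℓ × k` array with the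
Euclidean (Frobenius) norm. -/
def networkOutputs (σ : ℝ → ℝ) {n : ℕ → ℕ} {k : ℕ}
    (W : (ℓ : ℕ) → Matrix (Fin (n (ℓ + 1))) (Fin (n ℓ)) ℝ)
    (b : (ℓ : ℕ) → Fin (n (ℓ + 1)) → ℝ) (X : Fin k → Fin (n 0) → ℝ) (ℓ : ℕ) :
    EuclideanSpace ℝ (Fin (n ℓ) × Fin k) :=
  WithLp.toLp 2 fun p => networkOutput σ W b (X p.2) ℓ p.1

/-- Positions of the scalar parameters of a network with `L` layers of parameters:
`⟨ℓ, inl (i, j)⟩` is the weight `W⁽ˡ⁾[i, j]` and `⟨ℓ, inr i⟩` the bias `b⁽ˡ⁾[i]`. -/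
abbrev ParamIndex (n : ℕ → ℕ) (L : ℕ) : Type :=
  (ℓ : Fin L) × ((Fin (n (ℓ + 1)) × Fin (n ℓ)) ⊕ Fin (n (ℓ + 1)))

/-- The family of all scalar parameters of the layers `0, …, L - 1`. -/
def networkParam {Ω : Type*} {n : ℕ → ℕ} (L : ℕ)
    (W : (ℓ : ℕ) → Ω → Matrix (Fin (n (ℓ + 1))) (Fin (n ℓ)) ℝ)
    (b : (ℓ : ℕ) → Ω → Fin (n (ℓ + 1)) → ℝ) : ParamIndex n L → Ω → ℝ
  | ⟨ℓ, .inl (i, j)⟩ => fun ω => W ℓ ω i j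
  | ⟨ℓ, .inr i⟩ => fun ω => b ℓ ω i

/-- The weights and biases of the layers `0, …, L - 1` are all independent centred Gaussian
random variables, with variance `cw ℓ / n ℓ` for the weights and `cb ℓ` for the biases of
layer `ℓ`. Nothing is required of layers `ℓ ≥ L`. -/
structure IsGaussianInit {Ω : Type*} [MeasurableSpace Ω] (P : Measure Ω) {n : ℕ → ℕ} (L : ℕ)
    (cw cb : ℕ → ℝ≥0)
    (W : (ℓ : ℕ) → Ω → Matrix (Fin (n (ℓ + 1))) (Fin (n ℓ)) ℝ)
    (b : (ℓ : ℕ) → Ω → Fin (n (ℓ + 1)) → ℝ) : Prop where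
  weight_law : ∀ ℓ < L, ∀ i j,
    HasLaw (fun ω => W ℓ ω i j) (gaussianReal 0 (cw ℓ / (n ℓ : ℝ≥0))) P
  bias_law : ∀ ℓ < L, ∀ i, HasLaw (fun ω => b ℓ ω i) (gaussianReal 0 (cb ℓ)) P
  indep : iIndepFun (networkParam L W b) P

/-- The kernel `K⁽ˡ⁾[x, y]`, `ℓ ≥ 1`, of the Gaussian process of the network on `ℝᵈ`:
`K⁽¹⁾[x, y] = (cw 0 / d) ⟨x, y⟩ + cb 0` and, for `ℓ ≥ 2`,
`K⁽ˡ⁾[x, y] = cw (ℓ - 1) E[σ(G[x]) σ(G[y])] + cb (ℓ - 1)` with `(G[x], G[y])` the values at `x`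
and `y` of the centred Gaussian process with covariance kernel `K⁽ˡ⁻¹⁾`, which form a centred
Gaussian vector whose covariance matrix is the restriction of `K⁽ˡ⁻¹⁾` to these two points.
The value at `ℓ = 0` is a mere convention. -/
def nngpKernel (σ : ℝ → ℝ) (cw cb : ℕ → ℝ≥0) {d : ℕ} :
    ℕ → (Fin d → ℝ) → (Fin d → ℝ) → ℝ
  | 0, _, _ => 0
  | 1, x, y => (cw 0 / d : ℝ) * (x ⬝ᵥ y) + cb 0
  | ℓ + 2, x, y =>
      cw (ℓ + 1) * (∫ z, σ (z 0) * σ (z 1) ∂(multivariateGaussian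
        (0 : EuclideanSpace ℝ (Fin 2))
        !![nngpKernel σ cw cb (ℓ + 1) x x, nngpKernel σ cw cb (ℓ + 1) x y;
           nngpKernel σ cw cb (ℓ + 1) y x, nngpKernel σ cw cb (ℓ + 1) y y])) + cb (ℓ + 1)

/-- The law of `G⁽ˡ⁾[X]`: `m` independent copies of the process with kernel `K⁽ˡ⁾`, at the `k`
inputs `X`, i.e. the centred Gaussian on `ℝ^(m × k)` with covariance `Id_m ⊗ K⁽ˡ⁾[X]`. -/
def nngpLaw (σ : ℝ → ℝ) (cw cb : ℕ → ℝ≥0) {d k : ℕ} (X : Fin k → Fin d → ℝ) (ℓ m : ℕ) :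
    Measure (EuclideanSpace ℝ (Fin m × Fin k)) :=
  multivariateGaussian 0
    ((1 : Matrix (Fin m) (Fin m) ℝ) ⊗ₖ
      Matrix.of fun a a' : Fin k => nngpKernel σ cw cb ℓ (X a) (X a'))

end

/-!
The error made by replacing a wide network by its Gaussian limit is followed from layer to layer.
Let `f` be the array of outputs of a layer of size `n`, at distance `ρ` from the Gaussian array `G`
with independent rows of law `N(K)`, and let the next layer `W σ(·) + b` have `m` outputs and
weights of variance `c / n`. Its law on an input law `p` is called `layerStep p` below; since the
parameters of a layer are independent of the outputs of the layers before, the law of the next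
outputs is `layerStep (law f)` (`IsGaussianInit.map_networkOutputs_add_two`). Two errors arise.

* Replacing `f` by `G`. Applying the same `W`, `b` to an almost optimal coupling of `f` and `G`
  shows that the distance is multiplied by at most `√(m c / n) Lip(σ)`
  (`wasserstein2_layerStep_le`).
* Replacing the layer on `G` by the Gaussian array with the next kernel `B`. Given the rows `g` of
  `G`, the output `W σ(g) + b` is Gaussian with covariance `Id ⊗ A(g)`, where `A(g)` is an average
  of `n` independent terms with mean `B`. Coupling through matrix square roots gives the error
  `√m (E‖√A(g) - √B‖²)^(1/2)`. The matrix `B` may be singular, but `A(g)` almost surely vanishes on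
  its kernel, and along such matrices the square root is Lipschitz at `B`
  (`exists_trace_sq_sqrt_sub_sqrt_le`). The variance of the average is of order `1 / n`, hence the
  error is at most `√m C / √n` (`exists_wasserstein2_layerStep_multivariateGaussian_le`).

The triangle inequality for the Wasserstein distance (`wasserstein2_triangle`, by gluing couplings)
combines the two, and the first layer is exactly Gaussian. The factors `√n` and `1 / √n` cancel in
the induction, which leads to the stated sum.
-/

noncomputable section

open scoped MatrixOrder

/-! ### Gaussian vectors and their linear images -/

lemma PosSemidef.mul_mul_transpose_of_real {ι κ : Type*} [Fintype ι] [Fintype κ]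
    {S : Matrix ι ι ℝ} (hS : S.PosSemidef) (M : Matrix κ ι ℝ) : (M * S * Mᵀ).PosSemidef := by
  simpa using hS.mul_mul_conjTranspose_same M

section LinearImage

variable {ι κ : Type*} [Fintype ι] [Fintype κ]

lemma measurable_toLp_mulVec (M : Matrix κ ι ℝ) :
    Measurable fun z : EuclideanSpace ℝ ι => WithLp.toLp 2 (M *ᵥ z.ofLp) := by
  have : Continuous fun z : EuclideanSpace ℝ ι => WithLp.toLp 2 (M *ᵥ z.ofLp) := by fun_prop
  exact this.measurable

lemma charFun_map_mulVec (μ : Measure (EuclideanSpace ℝ ι)) (M : Matrix κ ι ℝ)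
    (t : EuclideanSpace ℝ κ) :
    charFun (μ.map fun z => WithLp.toLp 2 (M *ᵥ z.ofLp)) t =
      charFun μ (WithLp.toLp 2 (Mᵀ *ᵥ t.ofLp)) := by
  rw [charFun_apply, charFun_apply, integral_map (measurable_toLp_mulVec M).aemeasurable
    (by fun_prop)]
  refine integral_congr_ae (ae_of_all _ fun z => ?_)
  simp only [EuclideanSpace.inner_eq_star_dotProduct, star_trivial, mulVec_transpose]
  rw [dotProduct_mulVec]

lemma dotProduct_mul_mul_transpose_mulVec (M : Matrix κ ι ℝ) (S : Matrix ι ι ℝ) (t : κ → ℝ) :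
    t ⬝ᵥ (M * S * Mᵀ) *ᵥ t = (Mᵀ *ᵥ t) ⬝ᵥ S *ᵥ (Mᵀ *ᵥ t) := by
  rw [← mulVec_mulVec, ← mulVec_mulVec, dotProduct_mulVec, ← mulVec_transpose]

variable [DecidableEq ι] [DecidableEq κ]

/-- The image of `N(0, S)` under `M` is `N(0, M S Mᵀ)`. -/
theorem map_multivariateGaussian_mulVec {S : Matrix ι ι ℝ} (hS : S.PosSemidef)
    (M : Matrix κ ι ℝ) :
    (multivariateGaussian 0 S).map (fun z => WithLp.toLp 2 (M *ᵥ z.ofLp)) =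
      multivariateGaussian 0 (M * S * Mᵀ) := by
  have : IsProbabilityMeasure ((multivariateGaussian 0 S).map
      (fun z => WithLp.toLp 2 (M *ᵥ z.ofLp))) :=
    Measure.isProbabilityMeasure_map (measurable_toLp_mulVec M).aemeasurable
  refine Measure.ext_of_charFun (funext fun t => ?_)
  rw [charFun_map_mulVec, charFun_multivariateGaussian hS,
    charFun_multivariateGaussian (PosSemidef.mul_mul_transpose_of_real hS M),
    dotProduct_mul_mul_transpose_mulVec]
  simp

theorem map_pi_gaussianReal (v : ι → ℝ≥0) :
    (Measure.pi fun i => gaussianReal 0 (v i)).map (WithLp.toLp 2) =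
      multivariateGaussian 0 (diagonal fun i => (v i : ℝ)) := by
  refine Measure.ext_of_charFun (funext fun t => ?_)
  rw [charFun_pi, charFun_multivariateGaussian (PosSemidef.diagonal fun i => (v i).coe_nonneg)]
  simp only [charFun_gaussianReal, ← Complex.exp_sum]
  congr 1
  have h : t.ofLp ⬝ᵥ (diagonal fun i => (v i : ℝ)) *ᵥ t.ofLp = ∑ i, v i * t i ^ 2 := by
    simp only [dotProduct, mulVec_diagonal]
    exact Finset.sum_congr rfl fun i _ => by ring
  rw [h]
  simp [Finset.sum_div, ← Finset.sum_neg_distrib]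

theorem map_pi_gaussianReal_mulVec (v : ι → ℝ≥0) (M : Matrix κ ι ℝ) :
    (Measure.pi fun i => gaussianReal 0 (v i)).map (fun θ => WithLp.toLp 2 (M *ᵥ θ)) =
      multivariateGaussian 0 (M * diagonal (fun i => (v i : ℝ)) * Mᵀ) := by
  rw [← map_multivariateGaussian_mulVec (PosSemidef.diagonal fun i => (v i).coe_nonneg),
    ← map_pi_gaussianReal, Measure.map_map (measurable_toLp_mulVec M) (by fun_prop)]
  rfl

end LinearImage

theorem lintegral_enorm_sq_multivariateGaussian {ι : Type*} [Fintype ι] [DecidableEq ι]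
    {S : Matrix ι ι ℝ} (hS : S.PosSemidef) :
    ∫⁻ z, ‖z‖ₑ ^ 2 ∂(multivariateGaussian 0 S) = ENNReal.ofReal S.trace := by
  have hL : MemLp id 2 (multivariateGaussian 0 S) := IsGaussian.memLp_two_id
  have hi : ∀ i, MemLp (fun z : EuclideanSpace ℝ ι => z i) 2 (multivariateGaussian 0 S) := fun i =>
    (EuclideanSpace.proj (𝕜 := ℝ) i).comp_memLp' hL
  have h0 : ∀ i, ∫ z : EuclideanSpace ℝ ι, z i ∂(multivariateGaussian 0 S) = 0 := fun i => by
    have := (EuclideanSpace.proj (𝕜 := ℝ) i).integral_comp_comm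
      (IsGaussian.integrable_id (μ := multivariateGaussian 0 S))
    simpa using this
  have hv : ∀ i, ∫ z : EuclideanSpace ℝ ι, z i ^ 2 ∂(multivariateGaussian 0 S) = S i i :=
      fun i => by
    rw [← variance_eval_multivariateGaussian (μ := 0) hS i, variance_eq_sub (hi i), h0]
    simp
  have : ∀ z : EuclideanSpace ℝ ι, ‖z‖ₑ ^ 2 = ENNReal.ofReal (∑ i, z i ^ 2) := fun z => by
    rw [← ofReal_norm, ← ENNReal.ofReal_pow (norm_nonneg _), EuclideanSpace.real_norm_sq_eq]
  simp_rw [this]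
  rw [← ofReal_integral_eq_lintegral_ofReal, integral_finsetSum]
  · simp [hv, trace]
  · exact fun i _ => (hi i).integrable_sq
  · exact integrable_finsetSum _ fun i _ => (hi i).integrable_sq
  · exact ae_of_all _ fun z => by positivity

/-! ### The Wasserstein distance -/

/-- Gluing lemma: couplings of `(p, q)` and `(q, r)` are marginals of one measure, in which the
outer coordinates are conditionally independent given the middle one. The middle coordinate
comes first in the product. -/
theorem exists_gluing {E F G : Type*} [MeasurableSpace E] [MeasurableSpace F] [MeasurableSpace G]
    [StandardBorelSpace E] [Nonempty E] [StandardBorelSpace G] [Nonempty G]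
    (π₁ : Measure (E × F)) (π₂ : Measure (F × G)) [IsFiniteMeasure π₁] [IsFiniteMeasure π₂]
    (h : π₁.map Prod.snd = π₂.map Prod.fst) :
    ∃ γ : Measure (F × E × G), γ.map (fun z => (z.2.1, z.1)) = π₁ ∧
      γ.map (fun z => (z.1, z.2.2)) = π₂ := by
  set ρ₁ : Measure (F × E) := π₁.map Prod.swap with hρ₁
  have hfin : IsFiniteMeasure ρ₁ := by rw [hρ₁]; infer_instance
  have hfst : ρ₁.fst = π₂.fst := by
    rw [Measure.fst, Measure.fst, hρ₁, Measure.map_map measurable_fst measurable_swap, ← h]; rfl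
  refine ⟨π₂.fst ⊗ₘ (ρ₁.condKernel ×ₖ π₂.condKernel), ?_, ?_⟩
  · have h1 : (π₂.fst ⊗ₘ (ρ₁.condKernel ×ₖ π₂.condKernel)).map
        (Prod.map id Prod.fst) = ρ₁ := by
      rw [← Measure.compProd_map measurable_fst, ← Kernel.fst_eq, Kernel.fst_prod, ← hfst]
      exact ρ₁.disintegrate ρ₁.condKernel
    have h2 : (fun z : F × E × G => (z.2.1, z.1)) = Prod.swap ∘ Prod.map id Prod.fst := rfl
    rw [h2, ← Measure.map_map measurable_swap (by fun_prop), h1, hρ₁,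
      Measure.map_map measurable_swap measurable_swap]
    simp
  · have h1 : (fun z : F × E × G => (z.1, z.2.2)) = Prod.map id Prod.snd := rfl
    rw [h1, ← Measure.compProd_map measurable_snd, ← Kernel.snd_eq, Kernel.snd_prod]
    exact π₂.disintegrate π₂.condKernel

theorem wasserstein2_le_of_coupling {E : Type*} [NormedAddCommGroup E] [MeasurableSpace E]
    {p q : Measure E} (π : Measure (E × E)) (h₁ : π.map Prod.fst = p) (h₂ : π.map Prod.snd = q) :
    wasserstein2 p q ≤ (∫⁻ z, ‖z.1 - z.2‖ₑ ^ 2 ∂π) ^ (1 / 2 : ℝ) :=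
  iInf₂_le π ⟨h₁, h₂⟩

/-- Minkowski's inequality on the glued coupling. -/
theorem wasserstein2_triangle {E : Type*} [NormedAddCommGroup E] [MeasurableSpace E] [BorelSpace E]
    [SecondCountableTopology E] [CompleteSpace E] (p q r : Measure E) [IsFiniteMeasure p]
    [IsFiniteMeasure q] : wasserstein2 p r ≤ wasserstein2 p q + wasserstein2 q r := by
  have key : ∀ π₁ ∈ {π : Measure (E × E) | π.map Prod.fst = p ∧ π.map Prod.snd = q},
      ∀ π₂ ∈ {π : Measure (E × E) | π.map Prod.fst = q ∧ π.map Prod.snd = r},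
      wasserstein2 p r ≤ (∫⁻ z, ‖z.1 - z.2‖ₑ ^ 2 ∂π₁) ^ (1 / 2 : ℝ) +
        (∫⁻ z, ‖z.1 - z.2‖ₑ ^ 2 ∂π₂) ^ (1 / 2 : ℝ) := by
    rintro π₁ ⟨h₁, h₁'⟩ π₂ ⟨h₂, h₂'⟩
    have hf₁ : IsFiniteMeasure π₁ := by
      subst h₁
      exact Measure.isFiniteMeasure_of_map measurable_fst.aemeasurable
    have hf₂ : IsFiniteMeasure π₂ := by
      subst h₂
      exact Measure.isFiniteMeasure_of_map measurable_fst.aemeasurable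
    obtain ⟨γ, hγ₁, hγ₂⟩ := exists_gluing π₁ π₂ (h₁'.trans h₂.symm)
    have hm : Measurable fun z : E × E => ‖z.1 - z.2‖ₑ ^ 2 := by fun_prop
    have hm₁ : Measurable fun z : E × E × E => (z.2.1, z.1) := by fun_prop
    have hm₂ : Measurable fun z : E × E × E => (z.1, z.2.2) := by fun_prop
    refine (wasserstein2_le_of_coupling (γ.map fun z => (z.2.1, z.2.2)) ?_ ?_).trans ?_
    · rw [← h₁, ← hγ₁, Measure.map_map (by fun_prop) (by fun_prop),
        Measure.map_map (by fun_prop) (by fun_prop)]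
      rfl
    · rw [← h₂', ← hγ₂, Measure.map_map (by fun_prop) (by fun_prop),
        Measure.map_map (by fun_prop) (by fun_prop)]
      rfl
    · rw [← hγ₁, ← hγ₂, lintegral_map hm hm₁, lintegral_map hm hm₂,
        lintegral_map hm (by fun_prop)]
      have hM := ENNReal.lintegral_Lp_add_le (μ := γ) (p := 2)
        (f := fun z => ‖z.2.1 - z.1‖ₑ) (g := fun z => ‖z.1 - z.2.2‖ₑ)
        (by fun_prop) (by fun_prop) (by norm_num)
      simp only [ENNReal.rpow_two, Pi.add_apply] at hM
      refine le_trans ?_ hM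
      gcongr with z
      calc ‖z.2.1 - z.2.2‖ₑ = ‖(z.2.1 - z.1) + (z.1 - z.2.2)‖ₑ := by congr 1; abel
        _ ≤ _ := enorm_add_le _ _
  conv_rhs => unfold wasserstein2
  simp_rw [ENNReal.iInf_add, ENNReal.add_iInf]
  exact le_iInf₂ fun π₁ h₁ => le_iInf₂ fun π₂ h₂ => key π₁ h₁ π₂ h₂

theorem wasserstein2_self {E : Type*} [NormedAddCommGroup E] [MeasurableSpace E] [BorelSpace E]
    [SecondCountableTopology E] (p : Measure E) : wasserstein2 p p = 0 := by
  refine le_antisymm ((wasserstein2_le_of_coupling (p.map fun x => (x, x)) ?_ ?_).trans ?_) zero_le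
  · rw [Measure.map_map (by fun_prop) (by fun_prop)]; exact Measure.map_id
  · rw [Measure.map_map (by fun_prop) (by fun_prop)]; exact Measure.map_id
  · rw [lintegral_map (by fun_prop) (by fun_prop)]
    simp

/-! ### Perturbation of the matrix square root -/

open scoped Matrix.Norms.L2Operator in
theorem continuousOn_matrix_sqrt {k : Type*} [Fintype k] [DecidableEq k] :
    ContinuousOn (CFC.sqrt : Matrix k k ℝ → Matrix k k ℝ) {A | A.PosSemidef} := by
  have := CFC.continuousOn_sqrt (A := Matrix k k ℝ)
  simpa [nonneg_iff_posSemidef] using this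

/-- The square root is Lipschitz at a fixed `B ≥ 0`, which may be singular, along the matrices
`A ≥ 0` which vanish on the kernel of `B`. The vectors `e i` span that kernel. With `X = √A`,
`Y = √B` and `D = X - Y`, one has `tr (D (A - B)) = tr (D X D) + tr (D Y D)`; the first term is
nonnegative, and the second is at least `r ‖D‖²` for `r` the least nonzero eigenvalue of `Y`,
since `D` vanishes on the kernel of `Y`. -/
theorem exists_trace_sq_sqrt_sub_sqrt_le {k : Type*} [Fintype k] [DecidableEq k]
    {B : Matrix k k ℝ} (hB : B.PosSemidef) :
    ∃ c : ℝ, 0 < c ∧ ∃ e : k → k → ℝ, (∀ i, B *ᵥ e i = 0) ∧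
      ∀ A : Matrix k k ℝ, A.PosSemidef → (∀ i, A *ᵥ e i = 0) →
        ((CFC.sqrt A - CFC.sqrt B) * (CFC.sqrt A - CFC.sqrt B)ᵀ).trace ≤
          c * ∑ a, ∑ a', (A a a' - B a a') ^ 2 := by
  have hYY := CFC.sqrt_mul_sqrt_self B hB.nonneg
  have hY : (CFC.sqrt B).PosSemidef := (CFC.sqrt_nonneg B).posSemidef
  set Y := CFC.sqrt B
  set μ := hY.1.eigenvalues with hμdef
  have hμ0 : ∀ i, 0 ≤ μ i := hY.eigenvalues_nonneg
  -- `r` is the least nonzero eigenvalue of `√B`, capped at `1` to cover the case `B = 0`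
  obtain ⟨r, hr, hrμ⟩ : ∃ r : ℝ, 0 < r ∧ ∀ i, μ i ≠ 0 → r ≤ μ i := by
    refine ⟨(insert 1 ((Finset.univ.filter fun i => μ i ≠ 0).image μ)).min' (by simp), ?_, ?_⟩
    · rw [Finset.lt_min'_iff]
      simp only [Finset.mem_insert, Finset.mem_image, Finset.mem_filter, Finset.mem_univ, true_and]
      rintro y (rfl | ⟨i, hi, rfl⟩)
      · exact one_pos
      · exact lt_of_le_of_ne (hμ0 i) (Ne.symm hi)
    · intro i hi
      refine Finset.min'_le _ _ ?_
      simp only [Finset.mem_insert, Finset.mem_image, Finset.mem_filter, Finset.mem_univ, true_and]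
      exact Or.inr ⟨i, hi, rfl⟩
  refine ⟨1 / r ^ 2, by positivity,
    fun i => if μ i = 0 then (hY.1.eigenvectorBasis i).ofLp else 0, fun i => ?_, ?_⟩
  · beta_reduce
    split_ifs with hi
    · rw [← hYY, ← mulVec_mulVec, hY.1.mulVec_eigenvectorBasis]
      simp only [← hμdef, hi, zero_smul, mulVec_zero]
    · exact mulVec_zero _
  intro A hA hAe
  have hXX := CFC.sqrt_mul_sqrt_self A hA.nonneg
  have hX : (CFC.sqrt A).PosSemidef := (CFC.sqrt_nonneg A).posSemidef
  set X := CFC.sqrt A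
  set D := X - Y with hD
  have hXt : Xᵀ = X := by simpa using hX.1.eq
  have hYt : Yᵀ = Y := by simpa using hY.1.eq
  have hDt : Dᵀ = D := by rw [hD, transpose_sub, hXt, hYt]
  -- `A v = 0` gives `|√A v|² = ⟨v, A v⟩ = 0`
  have hXe : ∀ i, μ i = 0 → D *ᵥ (hY.1.eigenvectorBasis i).ofLp = 0 := by
    intro i hi
    have h1 := hAe i
    beta_reduce at h1
    rw [if_pos hi, ← hXX, ← mulVec_mulVec] at h1
    have h2 : X *ᵥ (hY.1.eigenvectorBasis i).ofLp = 0 := by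
      generalize (hY.1.eigenvectorBasis i).ofLp = v at h1 ⊢
      rw [← dotProduct_self_eq_zero, dotProduct_mulVec, ← mulVec_transpose, hXt, h1,
        zero_dotProduct]
    rw [hD, sub_mulVec, h2, hY.1.mulVec_eigenvectorBasis]
    simp only [← hμdef, hi, zero_smul, sub_zero]
  set U : Matrix k k ℝ := hY.1.eigenvectorUnitary.1 with hU
  have hUU : U * Uᵀ = 1 := by
    have := Unitary.mul_star_self_of_mem hY.1.eigenvectorUnitary.2
    simpa [star_eq_conjTranspose] using this
  have hspec : Y = U * diagonal μ * Uᵀ := by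
    have := hY.1.spectral_theorem
    rw [Unitary.conjStarAlgAut_apply] at this
    simpa [star_eq_conjTranspose, Function.comp_def] using this
  have hcol : ∀ i, μ i = 0 → ∀ a, (D * U) a i = 0 := by
    intro i hi a
    have := congrFun (hXe i hi) a
    simpa [mulVec, dotProduct, mul_apply, hU, IsHermitian.eigenvectorUnitary_apply] using this
  have htr1 : (D * Dᵀ).trace = ∑ i, ∑ a, (D * U) a i ^ 2 := by
    calc (D * Dᵀ).trace = (D * (U * Uᵀ) * Dᵀ).trace := by rw [hUU, mul_one]
      _ = ((D * U) * (D * U)ᵀ).trace := by rw [transpose_mul]; simp only [mul_assoc]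
      _ = _ := by
        rw [Finset.sum_comm]
        simp only [trace, diag_apply, mul_apply (M := D * U), transpose_apply, sq]
  have htr2 : (D * D * Y).trace = ∑ i, μ i * ∑ a, (D * U) a i ^ 2 := by
    calc (D * D * Y).trace = (D * U * diagonal μ * (D * U)ᵀ).trace := by
          rw [hspec, transpose_mul, hDt]
          rw [show D * D * (U * diagonal μ * Uᵀ) = D * (D * (U * diagonal μ * Uᵀ)) by
            simp only [mul_assoc], trace_mul_comm]
          simp only [mul_assoc]
      _ = _ := by
        simp only [trace, diag_apply, mul_apply (M := D * U * diagonal μ), mul_diagonal,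
          transpose_apply, Finset.mul_sum]
        rw [Finset.sum_comm]
        exact Finset.sum_congr rfl fun i _ => Finset.sum_congr rfl fun a _ => by ring
  have hlow : r * (D * Dᵀ).trace ≤ (D * D * Y).trace := by
    rw [htr1, htr2, Finset.mul_sum]
    refine Finset.sum_le_sum fun i _ => ?_
    by_cases hi : μ i = 0
    · simp [hcol i hi]
    · exact mul_le_mul_of_nonneg_right (hrμ i hi) (by positivity)
  have hDXD : 0 ≤ (D * X * D).trace := by
    have := (PosSemidef.mul_mul_transpose_of_real hX D).trace_nonneg
    rwa [hDt] at this
  have hsplit : (D * (A - B)).trace = (D * X * D).trace + (D * D * Y).trace := by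
    rw [← trace_add, ← hXX, ← hYY, hD]
    congr 1
    noncomm_ring
  have hdiag : (D * Dᵀ).trace = ∑ a, ∑ a', D a a' ^ 2 := by
    simp [trace, mul_apply, sq]
  -- Young's inequality with the weight `r`
  have hyoung : (D * (A - B)).trace ≤
      r / 2 * (D * Dᵀ).trace + 1 / (2 * r) * ∑ a, ∑ a', (A a a' - B a a') ^ 2 := by
    have hAt : ∀ a a', (A - B) a' a = A a a' - B a a' := fun a a' => by
      have h1 : A a' a = A a a' := by simpa using (hA.1.apply a a')
      have h2 : B a' a = B a a' := by simpa using (hB.1.apply a a')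
      simp [h1, h2]
    rw [hdiag]
    simp only [trace, diag_apply, mul_apply, hAt, Finset.mul_sum, ← Finset.sum_add_distrib]
    refine Finset.sum_le_sum fun a _ => Finset.sum_le_sum fun a' _ => ?_
    have h : r / 2 * D a a' ^ 2 + 1 / (2 * r) * (A a a' - B a a') ^ 2 -
        D a a' * (A a a' - B a a') = (r * D a a' - (A a a' - B a a')) ^ 2 / (2 * r) := by
      field_simp
      ring
    have h' : 0 ≤ (r * D a a' - (A a a' - B a a')) ^ 2 / (2 * r) := by positivity
    linarith
  have h3 : r / 2 * (D * Dᵀ).trace ≤ 1 / (2 * r) * ∑ a, ∑ a', (A a a' - B a a') ^ 2 := by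
    linarith
  have h4 := mul_le_mul_of_nonneg_left h3 (show 0 ≤ 2 / r by positivity)
  calc (D * Dᵀ).trace = 2 / r * (r / 2 * (D * Dᵀ).trace) := by field_simp
    _ ≤ _ := h4
    _ = _ := by field_simp

/-! ### Arrays with independent Gaussian rows -/

lemma measurable_flatten (m k : Type*) [Fintype m] [Fintype k] :
    Measurable fun g : m → EuclideanSpace ℝ k =>
      WithLp.toLp 2 fun p : m × k => g p.1 p.2 := by
  have : Continuous fun g : m → EuclideanSpace ℝ k =>
    WithLp.toLp 2 fun p : m × k => g p.1 p.2 := by fun_prop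
  exact this.measurable

/-- `N(0, Id ⊗ S)` is the law of an array with independent rows of law `N(0, S)`. -/
theorem map_pi_multivariateGaussian {m k : Type*} [Fintype m] [Fintype k] [DecidableEq m]
    [DecidableEq k] {S : Matrix k k ℝ} (hS : S.PosSemidef) :
    (Measure.pi fun _ : m => multivariateGaussian 0 S).map
        (fun g => WithLp.toLp 2 fun p : m × k => g p.1 p.2) =
      multivariateGaussian 0 ((1 : Matrix m m ℝ) ⊗ₖ S) := by
  have hmeas := measurable_flatten m k
  have : IsProbabilityMeasure ((Measure.pi fun _ : m => multivariateGaussian 0 S).map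
      (fun g => WithLp.toLp 2 fun p : m × k => g p.1 p.2)) :=
    Measure.isProbabilityMeasure_map hmeas.aemeasurable
  refine Measure.ext_of_charFun (funext fun t => ?_)
  have h1 : charFun ((Measure.pi fun _ : m => multivariateGaussian 0 S).map
        (fun g => WithLp.toLp 2 fun p : m × k => g p.1 p.2)) t =
      charFun ((Measure.pi fun _ : m => multivariateGaussian 0 S).map (WithLp.toLp 2))
        (WithLp.toLp 2 fun i => WithLp.toLp 2 fun a => t (i, a)) := by
    rw [charFun_apply, charFun_apply, integral_map hmeas.aemeasurable (by fun_prop),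
      integral_map (by fun_prop) (by fun_prop)]
    refine integral_congr_ae (ae_of_all _ fun θ => ?_)
    simp [PiLp.inner_apply, Fintype.sum_prod_type]
  rw [h1, charFun_pi, charFun_multivariateGaussian (PosSemidef.one.kronecker hS)]
  simp only [charFun_multivariateGaussian hS, ← Complex.exp_sum]
  congr 1
  have h2 : t.ofLp ⬝ᵥ ((1 : Matrix m m ℝ) ⊗ₖ S) *ᵥ t.ofLp =
      ∑ i, (fun a => t (i, a)) ⬝ᵥ S *ᵥ (fun a => t (i, a)) := by
    simp [dotProduct, mulVec, Fintype.sum_prod_type, one_apply, ite_mul]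
  rw [h2]
  simp [Finset.sum_div]

/-! ### A random layer and its action on laws -/

/-- The matrix of the linear map which sends the parameters `(W, b)` of a layer to its outputs
`W u + β b` at `k` inputs, the columns of `u`. The cases of interest are `β = 1`, the layer
itself, and `β = 0`, the difference of the outputs for two different `u`. -/
def layerMatrix (m : Type*) {n k : Type*} [DecidableEq m] (u : n → k → ℝ) (β : ℝ) :
    Matrix (m × k) ((m × n) ⊕ m) ℝ :=
  of fun p => Sum.elim (fun q => if p.1 = q.1 then u q.2 p.2 else 0)
    (fun i => if p.1 = i then β else 0)

/-- The law of the parameters of a layer: independent centred Gaussians, with variance `w` for the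
weights (indexed by `m × n`) and `b` for the biases (indexed by `m`). -/
def layerParamLaw (m n : Type*) [Fintype m] [Fintype n] (w b : ℝ≥0) :
    Measure ((m × n) ⊕ m → ℝ) :=
  Measure.pi fun i => gaussianReal 0 (Sum.elim (fun _ => w) (fun _ => b) i)

instance (m n : Type*) [Fintype m] [Fintype n] (w b : ℝ≥0) :
    IsProbabilityMeasure (layerParamLaw m n w b) := by
  unfold layerParamLaw; infer_instance

/-- The kernel `w ∑ⱼ uⱼ uⱼᵀ + b`: for `w`, `b` the variances of the weights and biases, the
covariance of each row of the outputs of a layer whose inputs are the columns of `u`. -/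
def empiricalKernel {n k : Type*} [Fintype n] (w b : ℝ) (u : n → k → ℝ) : Matrix k k ℝ :=
  of fun a a' => w * ∑ j, u j a * u j a' + b

/-- The law of `W σ(f) + b` for `f` of law `p` and independent parameters `(W, b)` of law
`layerParamLaw`. -/
def layerStep (m : Type*) {n k : Type*} [Fintype m] [DecidableEq m] [Fintype n] [Fintype k]
    (σ : ℝ → ℝ) (w b : ℝ≥0) (p : Measure (EuclideanSpace ℝ (n × k))) :
    Measure (EuclideanSpace ℝ (m × k)) :=
  (p.prod (layerParamLaw m n w b)).map fun z =>
    WithLp.toLp 2 (layerMatrix m (fun j a => σ (z.1 (j, a))) 1 *ᵥ z.2)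

section

variable {m n k : Type*} [Fintype m] [DecidableEq m] [Fintype n]

lemma layerMatrix_mulVec_apply (u : n → k → ℝ) (β : ℝ) (θ : (m × n) ⊕ m → ℝ) (p : m × k) :
    (layerMatrix m u β *ᵥ θ) p = ∑ j, θ (.inl (p.1, j)) * u j p.2 + β * θ (.inr p.1) := by
  simp [layerMatrix, mulVec, dotProduct, Fintype.sum_sum_type, Fintype.sum_prod_type, ite_mul,
    mul_comm]

lemma posSemidef_empiricalKernel [Finite k] {w b : ℝ} (hw : 0 ≤ w) (hb : 0 ≤ b) (u : n → k → ℝ) :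
    (empiricalKernel w b u).PosSemidef := by
  have h1 : empiricalKernel w b u =
      w • ((of u)ᵀ * (of u)) + b • vecMulVec (fun _ : k => (1 : ℝ)) (fun _ => 1) := by
    ext a a'
    simp [empiricalKernel, mul_apply, vecMulVec_apply]
  rw [h1]
  refine PosSemidef.add (PosSemidef.smul ?_ hw) (PosSemidef.smul ?_ hb)
  · simpa using posSemidef_conjTranspose_mul_self (of u)
  · simpa using posSemidef_vecMulVec_self_star (fun _ : k => (1 : ℝ))

theorem map_layerParamLaw [Fintype k] [DecidableEq n] [DecidableEq k] (w b : ℝ≥0)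
    (u : n → k → ℝ) (β : ℝ) :
    (layerParamLaw m n w b).map (fun θ => WithLp.toLp 2 (layerMatrix m u β *ᵥ θ)) =
      multivariateGaussian 0 ((1 : Matrix m m ℝ) ⊗ₖ empiricalKernel w (β ^ 2 * b) u) := by
  rw [layerParamLaw, map_pi_gaussianReal_mulVec]
  congr 1
  ext ⟨i, a⟩ ⟨i', a'⟩
  rw [mul_apply]
  simp only [mul_diagonal, transpose_apply, kroneckerMap_apply, one_apply]
  by_cases h : i = i'
  · subst h
    simp [layerMatrix, Fintype.sum_sum_type, Fintype.sum_prod_type, ite_mul, empiricalKernel,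
      Finset.mul_sum]
    congr 1
    · exact Finset.sum_congr rfl fun j _ => by ring
    · ring
  · have h' : ¬ i' = i := fun e => h e.symm
    simp [layerMatrix, Fintype.sum_sum_type, Fintype.sum_prod_type, ite_mul, h]

lemma measurable_layerMatrix_mulVec {Ω : Type*} [MeasurableSpace Ω] {u : Ω → n → k → ℝ}
    (hu : ∀ j a, Measurable fun ω => u ω j a) {θ : Ω → (m × n) ⊕ m → ℝ} (hθ : Measurable θ)
    (β : ℝ) : Measurable fun ω => WithLp.toLp 2 (layerMatrix m (u ω) β *ᵥ θ ω) := by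
  refine (WithLp.measurable_toLp 2 _).comp (measurable_pi_lambda _ fun p => ?_)
  simp only [layerMatrix_mulVec_apply]
  have := fun i => (measurable_pi_apply i).comp hθ
  simp only [Function.comp_def] at this
  fun_prop

lemma measurable_layerStep_map {σ : ℝ → ℝ} (hσ : Measurable σ) :
    Measurable fun z : EuclideanSpace ℝ (n × k) × ((m × n) ⊕ m → ℝ) =>
      WithLp.toLp 2 (layerMatrix m (fun j a => σ (z.1 (j, a))) 1 *ᵥ z.2) :=
  measurable_layerMatrix_mulVec (fun j a => hσ.comp (by fun_prop)) measurable_snd 1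

variable [Fintype k]

lemma isProbabilityMeasure_layerStep {σ : ℝ → ℝ} (hσ : Measurable σ) (w b : ℝ≥0)
    (p : Measure (EuclideanSpace ℝ (n × k))) [IsProbabilityMeasure p] :
    IsProbabilityMeasure (layerStep m σ w b p) :=
  Measure.isProbabilityMeasure_map (measurable_layerStep_map hσ).aemeasurable

theorem lintegral_enorm_sq_layerMatrix_mulVec (w b : ℝ≥0) (d : n → k → ℝ) :
    ∫⁻ θ, ‖WithLp.toLp 2 (layerMatrix m d 0 *ᵥ θ)‖ₑ ^ 2 ∂(layerParamLaw m n w b) =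
      ENNReal.ofReal (Fintype.card m * w * ∑ r : n × k, d r.1 r.2 ^ 2) := by
  classical
  have hmeas : Measurable fun θ : (m × n) ⊕ m → ℝ => WithLp.toLp 2 (layerMatrix m d 0 *ᵥ θ) :=
    measurable_layerMatrix_mulVec (u := fun _ => d) (fun _ _ => measurable_const) measurable_id 0
  have h1 : ∫⁻ x, ‖x‖ₑ ^ 2 ∂((layerParamLaw m n w b).map
      fun θ => WithLp.toLp 2 (layerMatrix m d 0 *ᵥ θ)) =
      ENNReal.ofReal (Fintype.card m * (empiricalKernel (w : ℝ) (0 ^ 2 * b) d).trace) := by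
    have hps : (empiricalKernel (w : ℝ) (0 ^ 2 * b) d).PosSemidef :=
      posSemidef_empiricalKernel w.coe_nonneg (by simp) d
    have hps' : ((1 : Matrix m m ℝ) ⊗ₖ empiricalKernel (w : ℝ) (0 ^ 2 * b) d).PosSemidef :=
      PosSemidef.one.kronecker hps
    rw [map_layerParamLaw, lintegral_enorm_sq_multivariateGaussian hps', trace_kronecker,
      trace_one]
  rw [lintegral_map (by fun_prop) hmeas] at h1
  rw [h1, mul_assoc]
  congr 2
  simp only [trace, diag_apply, empiricalKernel, of_apply, Fintype.sum_prod_type]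
  rw [Finset.sum_comm, Finset.mul_sum]
  simp [sq]

/-- A random layer is Lipschitz for the Wasserstein distance: apply the same parameters to both
components of a coupling. -/
theorem wasserstein2_layerStep_le {σ : ℝ → ℝ} {K : ℝ≥0} (hσ : LipschitzWith K σ) (w b : ℝ≥0)
    (p q : Measure (EuclideanSpace ℝ (n × k))) [IsProbabilityMeasure p] [IsProbabilityMeasure q] :
    wasserstein2 (layerStep m σ w b p) (layerStep m σ w b q) ≤
      ENNReal.ofReal (√(Fintype.card m * w) * K) * wasserstein2 p q := by
  classical
  have hσm : Measurable σ := hσ.continuous.measurable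
  set c : ℝ≥0∞ := ENNReal.ofReal (√(Fintype.card m * w) * K) with hc
  have key : ∀ π ∈ {π : Measure (EuclideanSpace ℝ (n × k) × EuclideanSpace ℝ (n × k)) |
      π.map Prod.fst = p ∧ π.map Prod.snd = q},
      wasserstein2 (layerStep m σ w b p) (layerStep m σ w b q) ≤
        c * (∫⁻ z, ‖z.1 - z.2‖ₑ ^ 2 ∂π) ^ (1 / 2 : ℝ) := by
    rintro π ⟨hp, hq⟩
    have hπ : IsFiniteMeasure π := by
      subst hp
      exact Measure.isFiniteMeasure_of_map measurable_fst.aemeasurable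
    have hF := measurable_layerStep_map (m := m) (n := n) (k := k) hσm
    set F : EuclideanSpace ℝ (n × k) × ((m × n) ⊕ m → ℝ) → EuclideanSpace ℝ (m × k) := fun z =>
      WithLp.toLp 2 (layerMatrix m (fun j a => σ (z.1 (j, a))) 1 *ᵥ z.2) with hFdef
    set ν := layerParamLaw m n w b
    have hG : Measurable fun z : (EuclideanSpace ℝ (n × k) × EuclideanSpace ℝ (n × k)) ×
        ((m × n) ⊕ m → ℝ) => (F (z.1.1, z.2), F (z.1.2, z.2)) :=
      (hF.comp (by fun_prop)).prodMk (hF.comp (by fun_prop))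
    refine (wasserstein2_le_of_coupling ((π.prod ν).map fun z => (F (z.1.1, z.2), F (z.1.2, z.2)))
      ?_ ?_).trans ?_
    · rw [Measure.map_map measurable_fst hG, layerStep, ← hp]
      conv_rhs => rw [← Measure.map_id (μ := layerParamLaw m n w b)]
      rw [Measure.map_prod_map _ _ measurable_fst measurable_id,
        Measure.map_map hF (by fun_prop)]
      rfl
    · rw [Measure.map_map measurable_snd hG, layerStep, ← hq]
      conv_rhs => rw [← Measure.map_id (μ := layerParamLaw m n w b)]
      rw [Measure.map_prod_map _ _ measurable_snd measurable_id,
        Measure.map_map hF (by fun_prop)]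
      rfl
    rw [lintegral_map (by fun_prop) hG, lintegral_prod _ (by fun_prop)]
    have hin : ∀ z : EuclideanSpace ℝ (n × k) × EuclideanSpace ℝ (n × k),
        ∫⁻ θ, ‖F (z.1, θ) - F (z.2, θ)‖ₑ ^ 2 ∂ν ≤ c ^ 2 * ‖z.1 - z.2‖ₑ ^ 2 := by
      intro z
      set d : n → k → ℝ := fun j a => σ (z.1 (j, a)) - σ (z.2 (j, a)) with hd
      have hdiff : ∀ θ, F (z.1, θ) - F (z.2, θ) = WithLp.toLp 2 (layerMatrix m d 0 *ᵥ θ) := by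
        intro θ
        ext r
        simp only [hFdef, PiLp.sub_apply, layerMatrix_mulVec_apply, hd, mul_sub,
          Finset.sum_sub_distrib]
        ring
      simp_rw [hdiff]
      rw [lintegral_enorm_sq_layerMatrix_mulVec,
        hc, ← ENNReal.ofReal_pow (by positivity), ← ofReal_norm,
        ← ENNReal.ofReal_pow (norm_nonneg _), ← ENNReal.ofReal_mul (by positivity),
        mul_pow, Real.sq_sqrt (by positivity), EuclideanSpace.real_norm_sq_eq]
      refine ENNReal.ofReal_le_ofReal ?_
      rw [mul_assoc (Fintype.card m * w : ℝ)]
      refine mul_le_mul_of_nonneg_left ?_ (by positivity)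
      rw [Finset.mul_sum]
      refine Finset.sum_le_sum fun r _ => ?_
      have h2 := hσ.dist_le_mul (z.1 r) (z.2 r)
      rw [Real.dist_eq, Real.dist_eq] at h2
      calc d r.1 r.2 ^ 2 = |σ (z.1 r) - σ (z.2 r)| ^ 2 := by rw [sq_abs]
        _ ≤ (K * |z.1 r - z.2 r|) ^ 2 := by gcongr
        _ = _ := by rw [mul_pow, sq_abs]; rfl
    calc (∫⁻ z, ∫⁻ θ, ‖F (z.1, θ) - F (z.2, θ)‖ₑ ^ 2 ∂ν ∂π) ^ (1 / 2 : ℝ)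
        ≤ (∫⁻ z, c ^ 2 * ‖z.1 - z.2‖ₑ ^ 2 ∂π) ^ (1 / 2 : ℝ) := by
          gcongr with z
          exact hin z
      _ = c * (∫⁻ z, ‖z.1 - z.2‖ₑ ^ 2 ∂π) ^ (1 / 2 : ℝ) := by
          rw [lintegral_const_mul _ (by fun_prop), ENNReal.mul_rpow_of_nonneg _ _ (by norm_num),
            ← ENNReal.rpow_two, ← ENNReal.rpow_mul]
          norm_num
  rcases eq_or_ne c 0 with h0 | h0
  · -- the product coupling may have infinite cost, but `0 * ∞ = 0`
    have := key (p.prod q) ⟨by simp, by simp⟩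
    rw [h0, zero_mul] at this
    rw [h0, zero_mul]
    exact this
  · have hct : c ≠ ⊤ := ENNReal.ofReal_ne_top
    conv_rhs => unfold wasserstein2
    simp_rw [ENNReal.mul_iInf_of_ne h0 hct]
    exact le_iInf₂ key

end

/-! ### Moments of the empirical kernel -/

/-- Joint laws with the same first marginal and the same conditional laws agree. -/
theorem map_prod_congr_of_forall {α β β' γ : Type*} [MeasurableSpace α] [MeasurableSpace β]
    [MeasurableSpace β'] [MeasurableSpace γ] (μ : Measure α) {ν : Measure β} {ν' : Measure β'}
    [SFinite ν] [SFinite ν'] {F : α × β → γ} {F' : α × β' → γ} (hF : Measurable F)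
    (hF' : Measurable F')
    (h : ∀ x, ν.map (fun y => F (x, y)) = ν'.map (fun y => F' (x, y))) :
    (μ.prod ν).map F = (μ.prod ν').map F' := by
  ext s hs
  rw [Measure.map_apply hF hs, Measure.map_apply hF' hs, Measure.prod_apply (hF hs),
    Measure.prod_apply (hF' hs)]
  refine lintegral_congr fun x => ?_
  have h₁ : ν (Prod.mk x ⁻¹' (F ⁻¹' s)) = ν.map (fun y => F (x, y)) s :=
    (Measure.map_apply (hF.comp measurable_prodMk_left) hs).symm
  have h₂ : ν' (Prod.mk x ⁻¹' (F' ⁻¹' s)) = ν'.map (fun y => F' (x, y)) s :=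
    (Measure.map_apply (hF'.comp measurable_prodMk_left) hs).symm
  rw [h₁, h₂, h x]

/-- Quadratic forms commute with the entrywise integral of a random matrix. -/
lemma dotProduct_mulVec_integral {k : Type*} [Fintype k] {Ω : Type*} [MeasurableSpace Ω]
    {P : Measure Ω}
    {A : Ω → Matrix k k ℝ} (hA : ∀ a a', Integrable (fun ω => A ω a a') P) (x : k → ℝ) :
    Integrable (fun ω => x ⬝ᵥ A ω *ᵥ x) P ∧
      ∫ ω, x ⬝ᵥ A ω *ᵥ x ∂P = x ⬝ᵥ (of fun a a' => ∫ ω, A ω a a' ∂P) *ᵥ x := by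
  have hi : ∀ a, Integrable (fun ω => ∑ a', A ω a a' * x a') P := fun a =>
    integrable_finsetSum _ fun a' _ => (hA a a').mul_const _
  simp only [dotProduct, mulVec, of_apply]
  refine ⟨integrable_finsetSum _ fun a _ => (hi a).const_mul _, ?_⟩
  rw [integral_finsetSum _ fun a _ => (hi a).const_mul _]
  refine Finset.sum_congr rfl fun a _ => ?_
  rw [integral_const_mul, integral_finsetSum _ fun a' _ => (hA a a').mul_const _]
  simp_rw [integral_mul_const]

/-- One step `S ↦ w E[σ(g) σ(g)ᵀ] + b`, `g ~ N(0, S)`, of the recursion for the kernels of the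
Gaussian process. -/
def activationKernel {k : Type*} [Fintype k] [DecidableEq k] (σ : ℝ → ℝ) (w b : ℝ)
    (S : Matrix k k ℝ) : Matrix k k ℝ :=
  of fun a a' => w * (∫ z : EuclideanSpace ℝ k, σ (z a) * σ (z a') ∂(multivariateGaussian 0 S)) + b

section

variable {k : Type*} [Fintype k] [DecidableEq k]

lemma memLp_lipschitz_mul_lipschitz {σ : ℝ → ℝ} {K : ℝ≥0} (hσ : LipschitzWith K σ)
    (S : Matrix k k ℝ) (a a' : k) :
    MemLp (fun z : EuclideanSpace ℝ k => σ (z a) * σ (z a')) 2 (multivariateGaussian 0 S) := by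
  have h4 : ∀ a, MemLp (fun z : EuclideanSpace ℝ k => σ (z a)) 4 (multivariateGaussian 0 S) := by
    intro a
    have h0 : MemLp id 4 (multivariateGaussian 0 S) :=
      IsGaussian.memLp_id (multivariateGaussian 0 S) 4 (by simp)
    have h1 : MemLp (fun z : EuclideanSpace ℝ k => z a) 4 (multivariateGaussian 0 S) :=
      (EuclideanSpace.proj (𝕜 := ℝ) a).comp_memLp' h0
    have h2 : MemLp (fun z : EuclideanSpace ℝ k => |σ 0| + K * |z a|) 4
        (multivariateGaussian 0 S) := (memLp_const |σ 0|).add (h1.abs.const_mul (K : ℝ))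
    refine h2.mono' ?_ (ae_of_all _ fun z => ?_)
    · exact (hσ.continuous.comp (by fun_prop)).aestronglyMeasurable
    · have h3 := hσ.dist_le_mul (z a) 0
      rw [Real.dist_eq, Real.dist_eq, sub_zero] at h3
      rw [Real.norm_eq_abs]
      have h5 : |σ (z a)| ≤ |σ (z a) - σ 0| + |σ 0| := by
        simpa using abs_add_le (σ (z a) - σ 0) (σ 0)
      linarith
  have : ENNReal.HolderTriple 4 4 2 := ⟨by
    rw [← two_mul, show (4 : ℝ≥0∞) = 2 * 2 by norm_num, ENNReal.mul_inv (by simp) (by simp),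
      ← mul_assoc, ENNReal.mul_inv_cancel (by simp) (by simp), one_mul]⟩
  exact (h4 a').mul (h4 a)

variable {n : Type*} [Fintype n]

/-- The empirical kernel of `n` independent samples is square integrable and unbiased, and the
variance of its entries is that of a single sample divided by `n`. -/
theorem empiricalKernel_moments [Nonempty n] {σ : ℝ → ℝ} {K : ℝ≥0} (hσ : LipschitzWith K σ)
    (w b : ℝ) (S : Matrix k k ℝ) (a a' : k) :
    MemLp (fun g : n → EuclideanSpace ℝ k =>
        empiricalKernel (w / Fintype.card n) b (fun j a => σ (g j a)) a a') 2
        (Measure.pi fun _ => multivariateGaussian 0 S) ∧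
      (∫ g : n → EuclideanSpace ℝ k,
        empiricalKernel (w / Fintype.card n) b (fun j a => σ (g j a)) a a'
        ∂(Measure.pi fun _ => multivariateGaussian 0 S)) = activationKernel σ w b S a a' ∧
      (∫ g : n → EuclideanSpace ℝ k,
        (empiricalKernel (w / Fintype.card n) b (fun j a => σ (g j a)) a a' -
          activationKernel σ w b S a a') ^ 2
        ∂(Measure.pi fun _ => multivariateGaussian 0 S)) =
        w ^ 2 * Var[fun z : EuclideanSpace ℝ k => σ (z a) * σ (z a'); multivariateGaussian 0 S] /
          Fintype.card n := by
  have hn : (Fintype.card n : ℝ) ≠ 0 := by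
    exact_mod_cast Fintype.card_ne_zero
  have hφ := memLp_lipschitz_mul_lipschitz hσ S a a'
  set φ : EuclideanSpace ℝ k → ℝ := fun z => σ (z a) * σ (z a') with hφdef
  set γ : Measure (n → EuclideanSpace ℝ k) := Measure.pi fun _ => multivariateGaussian 0 S with hγ
  have hj : ∀ j : n, MemLp (fun g : n → EuclideanSpace ℝ k => φ (g j)) 2 γ := fun j =>
    hφ.comp_measurePreserving (measurePreserving_eval _ j)
  have hje : ∀ j : n, ∫ g, φ (g j) ∂γ = ∫ z, φ z ∂(multivariateGaussian 0 S) := fun j =>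
    integral_comp_eval hφ.aestronglyMeasurable
  have hsum : MemLp (fun g : n → EuclideanSpace ℝ k => ∑ j, φ (g j)) 2 γ :=
    memLp_finsetSum _ fun j _ => hj j
  have hA : (fun g : n → EuclideanSpace ℝ k =>
        empiricalKernel (w / Fintype.card n) b (fun j a => σ (g j a)) a a') =
      fun g => w / Fintype.card n * ∑ j, φ (g j) + b := rfl
  have hmem : MemLp (fun g : n → EuclideanSpace ℝ k => w / Fintype.card n * ∑ j, φ (g j) + b) 2 γ :=
    (hsum.const_mul _).add (memLp_const b)
  have hmean : ∫ g, (w / Fintype.card n * ∑ j, φ (g j) + b) ∂γ = activationKernel σ w b S a a' := by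
    rw [integral_add ((hsum.const_mul _).integrable (by norm_num)) (integrable_const _),
      integral_const_mul, integral_finsetSum _ fun j _ => (hj j).integrable (by norm_num)]
    rw [Finset.sum_congr rfl fun j _ => hje j]
    simp only [Finset.sum_const, Finset.card_univ, nsmul_eq_mul, integral_const,
      probReal_univ, one_smul, activationKernel, of_apply, hφdef]
    field_simp
  refine ⟨hA ▸ hmem, by rw [hA]; exact hmean, ?_⟩
  have hvar : Var[fun g : n → EuclideanSpace ℝ k => w / Fintype.card n * ∑ j, φ (g j) + b; γ] =
      w ^ 2 * Var[φ; multivariateGaussian 0 S] / Fintype.card n := by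
    rw [variance_add_const (hsum.const_mul _).aestronglyMeasurable, variance_const_mul]
    have h := variance_sum_pi (μ := fun _ : n => multivariateGaussian (0 : EuclideanSpace ℝ k) S)
      (X := fun _ => φ) fun _ => hφ
    have h' : (∑ i, fun g : n → EuclideanSpace ℝ k => φ (g i)) = fun g => ∑ j, φ (g j) := by
      ext g; simp
    rw [h'] at h
    rw [h]
    simp only [Finset.sum_const, Finset.card_univ, nsmul_eq_mul]
    field_simp
  rw [← hvar, variance_eq_integral hmem.aemeasurable, hmean]
  rfl

/-- The kernel is the expectation of an empirical kernel, here of a single sample. -/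
theorem posSemidef_activationKernel {σ : ℝ → ℝ} {K : ℝ≥0} (hσ : LipschitzWith K σ) {w b : ℝ}
    (hw : 0 ≤ w) (hb : 0 ≤ b) (S : Matrix k k ℝ) : (activationKernel σ w b S).PosSemidef := by
  refine PosSemidef.of_dotProduct_mulVec_nonneg ?_ fun x => ?_
  · ext a a'
    simp [activationKernel, mul_comm]
  · have h := dotProduct_mulVec_integral
      (P := Measure.pi fun _ : Unit => multivariateGaussian (0 : EuclideanSpace ℝ k) S)
      (A := fun g => empiricalKernel (w / Fintype.card Unit) b (fun j a => σ (g j a)))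
      (fun a a' => (empiricalKernel_moments hσ w b S a a').1.integrable (by norm_num)) x
    have h2 : (of fun a a' => ∫ g : Unit → EuclideanSpace ℝ k,
        empiricalKernel (w / Fintype.card Unit) b (fun j a => σ (g j a)) a a'
        ∂(Measure.pi fun _ => multivariateGaussian 0 S)) = activationKernel σ w b S := by
      ext a a'
      exact (empiricalKernel_moments hσ w b S a a').2.1
    rw [h2] at h
    rw [star_trivial, ← h.2]
    refine integral_nonneg fun g => ?_
    simpa using (posSemidef_empiricalKernel (by positivity) hb _).dotProduct_mulVec_nonneg x

/-- The empirical kernel vanishes almost surely on the kernel of its expectation, because its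
quadratic form is nonnegative there with mean zero. -/
theorem ae_empiricalKernel_mulVec_eq_zero [Nonempty n] {σ : ℝ → ℝ} {K : ℝ≥0}
    (hσ : LipschitzWith K σ) {w b : ℝ} (hw : 0 ≤ w) (hb : 0 ≤ b) (S : Matrix k k ℝ) {x : k → ℝ}
    (hx : activationKernel σ w b S *ᵥ x = 0) :
    ∀ᵐ g : n → EuclideanSpace ℝ k ∂(Measure.pi fun _ => multivariateGaussian 0 S),
      empiricalKernel (w / Fintype.card n) b (fun j a => σ (g j a)) *ᵥ x = 0 := by
  have h := dotProduct_mulVec_integral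
    (P := Measure.pi fun _ : n => multivariateGaussian (0 : EuclideanSpace ℝ k) S)
    (A := fun g => empiricalKernel (w / Fintype.card n) b (fun j a => σ (g j a)))
    (fun a a' => (empiricalKernel_moments hσ w b S a a').1.integrable (by norm_num)) x
  have h2 : (of fun a a' => ∫ g : n → EuclideanSpace ℝ k,
      empiricalKernel (w / Fintype.card n) b (fun j a => σ (g j a)) a a'
      ∂(Measure.pi fun _ => multivariateGaussian 0 S)) = activationKernel σ w b S := by
    ext a a'
    exact (empiricalKernel_moments hσ w b S a a').2.1
  have hps : ∀ g : n → EuclideanSpace ℝ k,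
      (empiricalKernel (w / Fintype.card n) b (fun j a => σ (g j a))).PosSemidef := fun g =>
    posSemidef_empiricalKernel (by positivity) hb _
  rw [h2, hx, dotProduct_zero, integral_eq_zero_iff_of_nonneg
    (fun g => by simpa using (hps g).dotProduct_mulVec_nonneg x) h.1] at h
  filter_upwards [h.2] with g hg
  refine ((hps g).dotProduct_mulVec_zero_iff x).1 ?_
  simpa using hg

end

/-! ### One layer applied to independent Gaussian rows -/

lemma measurable_sqrt_empiricalKernel {k n : Type*} [Fintype k] [DecidableEq k] [Fintype n]
    {σ : ℝ → ℝ} (hσ : Continuous σ) {w b : ℝ} (hw : 0 ≤ w) (hb : 0 ≤ b) (a a' : k) :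
    Measurable fun g : n → EuclideanSpace ℝ k =>
      CFC.sqrt (empiricalKernel w b (fun j a => σ (g j a))) a a' := by
  have h1 : Continuous fun g : n → EuclideanSpace ℝ k =>
      empiricalKernel w b (fun j a => σ (g j a)) := by
    refine continuous_matrix fun a a' => ?_
    simp only [empiricalKernel, of_apply]
    fun_prop
  have h2 : Continuous fun g : n → EuclideanSpace ℝ k =>
      CFC.sqrt (empiricalKernel w b (fun j a => σ (g j a))) :=
    continuousOn_matrix_sqrt.comp_continuous h1 fun g => posSemidef_empiricalKernel hw hb _
  exact ((continuous_apply a').comp ((continuous_apply a).comp h2)).measurable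

lemma map_stdGaussian_one_kronecker_sqrt {m k : Type*} [Fintype m] [Fintype k] [DecidableEq m]
    [DecidableEq k] {A : Matrix k k ℝ} (hA : A.PosSemidef) :
    (stdGaussian (EuclideanSpace ℝ (m × k))).map
        (fun z => WithLp.toLp 2 (((1 : Matrix m m ℝ) ⊗ₖ CFC.sqrt A) *ᵥ z.ofLp)) =
      multivariateGaussian 0 ((1 : Matrix m m ℝ) ⊗ₖ A) := by
  have hX : (CFC.sqrt A)ᵀ = CFC.sqrt A := by
    simpa using (CFC.sqrt_nonneg A).posSemidef.1.eq
  rw [← multivariateGaussian_zero_one, map_multivariateGaussian_mulVec PosSemidef.one, mul_one,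
    ← kroneckerMap_transpose, transpose_one, hX, ← mul_kronecker_mul, one_mul,
    CFC.sqrt_mul_sqrt_self A hA.nonneg]

lemma lintegral_enorm_sq_one_kronecker_mulVec {m k : Type*} [Fintype m] [Fintype k]
    [DecidableEq m] [DecidableEq k] (D : Matrix k k ℝ) :
    ∫⁻ z, ‖WithLp.toLp 2 (((1 : Matrix m m ℝ) ⊗ₖ D) *ᵥ z.ofLp)‖ₑ ^ 2
        ∂(stdGaussian (EuclideanSpace ℝ (m × k))) =
      ENNReal.ofReal (Fintype.card m * (D * Dᵀ).trace) := by
  have hmeas := measurable_toLp_mulVec ((1 : Matrix m m ℝ) ⊗ₖ D)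
  have hps : (D * Dᵀ).PosSemidef := by simpa using posSemidef_self_mul_conjTranspose D
  have hps' : ((1 : Matrix m m ℝ) ⊗ₖ (D * Dᵀ)).PosSemidef := PosSemidef.one.kronecker hps
  have h1 : ∫⁻ x, ‖x‖ₑ ^ 2 ∂((stdGaussian (EuclideanSpace ℝ (m × k))).map
      fun z => WithLp.toLp 2 (((1 : Matrix m m ℝ) ⊗ₖ D) *ᵥ z.ofLp)) =
      ENNReal.ofReal (Fintype.card m * (D * Dᵀ).trace) := by
    rw [← multivariateGaussian_zero_one, map_multivariateGaussian_mulVec PosSemidef.one, mul_one,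
      ← kroneckerMap_transpose, transpose_one, ← mul_kronecker_mul, one_mul,
      lintegral_enorm_sq_multivariateGaussian hps', trace_kronecker, trace_one]
  rwa [lintegral_map (by fun_prop) hmeas] at h1

lemma measurable_one_kronecker_sqrt_mulVec {k m n : Type*} [Fintype k] [DecidableEq k] [Fintype m]
    [DecidableEq m] [Fintype n] {σ : ℝ → ℝ} (hσ : Continuous σ) {w b : ℝ} (hw : 0 ≤ w)
    (hb : 0 ≤ b) :
    Measurable fun z : (n → EuclideanSpace ℝ k) × EuclideanSpace ℝ (m × k) =>
      WithLp.toLp 2 (((1 : Matrix m m ℝ) ⊗ₖ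
        CFC.sqrt (empiricalKernel w b (fun j a => σ (z.1 j a)))) *ᵥ z.2.ofLp) := by
  refine (WithLp.measurable_toLp 2 _).comp (measurable_pi_lambda _ fun p => ?_)
  simp only [mulVec, dotProduct, kroneckerMap_apply]
  refine Finset.measurable_sum _ fun q _ => Measurable.mul ?_ (by fun_prop)
  exact measurable_const.mul
    ((measurable_sqrt_empiricalKernel hσ hw hb p.2 q.2).comp measurable_fst)

/-- Conditionally on the rows `g` of its input, the output of a layer is Gaussian with covariance
`Id ⊗ A(g)`, hence it can be realized as `√A(g)` applied to the rows of a standard Gaussian. -/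
theorem layerStep_multivariateGaussian {k m n : Type*} [Fintype k] [DecidableEq k] [Fintype m]
    [DecidableEq m] [Fintype n] [DecidableEq n] {σ : ℝ → ℝ} (hσ : Continuous σ) (w b : ℝ≥0)
    {S : Matrix k k ℝ} (hS : S.PosSemidef) :
    ((Measure.pi fun _ : n => multivariateGaussian (0 : EuclideanSpace ℝ k) S).prod
        (stdGaussian (EuclideanSpace ℝ (m × k)))).map
        (fun z => WithLp.toLp 2 (((1 : Matrix m m ℝ) ⊗ₖ
          CFC.sqrt (empiricalKernel w b (fun j a => σ (z.1 j a)))) *ᵥ z.2.ofLp)) =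
      layerStep m σ w b (multivariateGaussian 0 ((1 : Matrix n n ℝ) ⊗ₖ S)) := by
  have hflat := measurable_flatten n k
  have hL := measurable_layerStep_map (m := m) (n := n) (k := k) hσ.measurable
  rw [layerStep, ← map_pi_multivariateGaussian hS]
  conv_rhs => rw [← Measure.map_id (μ := layerParamLaw m n w b)]
  rw [Measure.map_prod_map _ _ hflat measurable_id, Measure.map_map hL (by fun_prop)]
  refine map_prod_congr_of_forall _
    (measurable_one_kronecker_sqrt_mulVec hσ w.coe_nonneg b.coe_nonneg)
    (hL.comp (by fun_prop)) fun g => ?_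
  simp only [Function.comp_def, Prod.map, id]
  rw [map_stdGaussian_one_kronecker_sqrt
    (posSemidef_empiricalKernel w.coe_nonneg b.coe_nonneg _), map_layerParamLaw]
  simp

/-- A layer with `n` independent Gaussian rows as input is at distance `O(√(m / n))` from the
Gaussian law with the averaged covariance `B`: use the same standard Gaussian array `z` for
`√A(g) z` and `√B z`. The mean squared distance is `m E‖√A(g) - √B‖² ≤ c m E‖A(g) - B‖²`, and the
last expectation is a variance of order `1 / n`. -/
theorem exists_wasserstein2_layerStep_multivariateGaussian_le {k : Type*} [Fintype k]
    [DecidableEq k] {σ : ℝ → ℝ} {K : ℝ≥0} (hσ : LipschitzWith K σ) (w b : ℝ≥0) {S : Matrix k k ℝ}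
    (hS : S.PosSemidef) :
    ∃ C : ℝ, 0 < C ∧ ∀ m n : ℕ, 1 ≤ n →
      wasserstein2
        (layerStep (Fin m) σ (w / (n : ℝ≥0)) b
          (multivariateGaussian 0 ((1 : Matrix (Fin n) (Fin n) ℝ) ⊗ₖ S)))
        (multivariateGaussian 0 ((1 : Matrix (Fin m) (Fin m) ℝ) ⊗ₖ activationKernel σ w b S)) ≤
      ENNReal.ofReal (√m * C / √n) := by
  set B := activationKernel σ w b S with hBdef
  have hB : B.PosSemidef := posSemidef_activationKernel hσ w.coe_nonneg b.coe_nonneg S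
  obtain ⟨c, hc, e, hBe, hAB⟩ := exists_trace_sq_sqrt_sub_sqrt_le hB
  set V : ℝ := ∑ a, ∑ a', (w : ℝ) ^ 2 *
    Var[fun z : EuclideanSpace ℝ k => σ (z a) * σ (z a'); multivariateGaussian 0 S] with hV
  have hV0 : 0 ≤ V := Finset.sum_nonneg fun a _ => Finset.sum_nonneg fun a' _ =>
    mul_nonneg (by positivity) (variance_nonneg _ _)
  -- `+ 1` keeps the constant positive when the variance vanishes
  refine ⟨√(c * V + 1), by positivity, fun m n hn => ?_⟩
  have : Nonempty (Fin n) := ⟨⟨0, hn⟩⟩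
  have hn0 : (0 : ℝ) < n := by exact_mod_cast hn
  set γ : Measure (Fin n → EuclideanSpace ℝ k) := Measure.pi fun _ => multivariateGaussian 0 S
  set ν := stdGaussian (EuclideanSpace ℝ (Fin m × k))
  set A : (Fin n → EuclideanSpace ℝ k) → Matrix k k ℝ := fun g =>
    empiricalKernel ((w : ℝ) / Fintype.card (Fin n)) b (fun j a => σ (g j a)) with hA
  have hw' : (0 : ℝ) ≤ (w : ℝ) / Fintype.card (Fin n) := by positivity
  have hAps : ∀ g, (A g).PosSemidef := fun g => posSemidef_empiricalKernel hw' b.coe_nonneg _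
  set F : (Fin n → EuclideanSpace ℝ k) × EuclideanSpace ℝ (Fin m × k) →
      EuclideanSpace ℝ (Fin m × k) := fun z =>
    WithLp.toLp 2 (((1 : Matrix (Fin m) (Fin m) ℝ) ⊗ₖ CFC.sqrt (A z.1)) *ᵥ z.2.ofLp) with hF
  set F' : (Fin n → EuclideanSpace ℝ k) × EuclideanSpace ℝ (Fin m × k) →
      EuclideanSpace ℝ (Fin m × k) := fun z =>
    WithLp.toLp 2 (((1 : Matrix (Fin m) (Fin m) ℝ) ⊗ₖ CFC.sqrt B) *ᵥ z.2.ofLp) with hF'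
  have hFm : Measurable F :=
    measurable_one_kronecker_sqrt_mulVec hσ.continuous hw' b.coe_nonneg
  have hF'm : Measurable F' := (measurable_toLp_mulVec _).comp measurable_snd
  have hcm : Measurable fun z => ‖F z - F' z‖ₑ ^ 2 := (hFm.sub hF'm).enorm.pow_const 2
  have hfirst : (γ.prod ν).map F = layerStep (Fin m) σ (w / (n : ℝ≥0)) b
      (multivariateGaussian 0 ((1 : Matrix (Fin n) (Fin n) ℝ) ⊗ₖ S)) := by
    rw [← layerStep_multivariateGaussian hσ.continuous _ _ hS]
    simp only [hF, hA, Fintype.card_fin, NNReal.coe_div, NNReal.coe_natCast]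
    rfl
  have hsecond : (γ.prod ν).map F' =
      multivariateGaussian 0 ((1 : Matrix (Fin m) (Fin m) ℝ) ⊗ₖ B) := by
    rw [← map_stdGaussian_one_kronecker_sqrt hB]
    have h1 : F' = (fun z : EuclideanSpace ℝ (Fin m × k) => WithLp.toLp 2
      (((1 : Matrix (Fin m) (Fin m) ℝ) ⊗ₖ CFC.sqrt B) *ᵥ z.ofLp)) ∘ Prod.snd := rfl
    rw [h1, ← Measure.map_map (measurable_toLp_mulVec _) measurable_snd]
    simp [ν]
  have hmom := fun a a' => empiricalKernel_moments (n := Fin n) hσ (w : ℝ) b S a a'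
  have hint : ∀ a a', Integrable (fun g => (A g a a' - B a a') ^ 2) γ := fun a a' =>
    ((hmom a a').1.sub (memLp_const _)).integrable_sq
  have hae : ∀ᵐ g ∂γ, ∀ i, A g *ᵥ e i = 0 := ae_all_iff.2 fun i =>
    ae_empiricalKernel_mulVec_eq_zero hσ w.coe_nonneg b.coe_nonneg S (hBe i)
  have hcost : ∫⁻ z, ‖F z - F' z‖ₑ ^ 2 ∂(γ.prod ν) ≤ ENNReal.ofReal (m * (c * V / n)) := by
    rw [lintegral_prod _ hcm.aemeasurable]
    calc ∫⁻ g, ∫⁻ z, ‖F (g, z) - F' (g, z)‖ₑ ^ 2 ∂ν ∂γ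
        ≤ ∫⁻ g, ENNReal.ofReal (m * (c * ∑ a, ∑ a', (A g a a' - B a a') ^ 2)) ∂γ := by
          refine lintegral_mono_ae ?_
          filter_upwards [hae] with g hg
          have hdiff : ∀ z, F (g, z) - F' (g, z) = WithLp.toLp 2
              (((1 : Matrix (Fin m) (Fin m) ℝ) ⊗ₖ (CFC.sqrt (A g) - CFC.sqrt B)) *ᵥ z.ofLp) := by
            intro z
            rw [sub_eq_add_neg (CFC.sqrt (A g)), kronecker_add, ← neg_one_smul ℝ (CFC.sqrt B),
              kronecker_smul, add_mulVec, neg_one_smul, neg_mulVec, ← sub_eq_add_neg]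
            rfl
          simp_rw [hdiff]
          rw [lintegral_enorm_sq_one_kronecker_mulVec, Fintype.card_fin]
          exact ENNReal.ofReal_le_ofReal
            (mul_le_mul_of_nonneg_left (hAB (A g) (hAps g) hg) (by positivity))
      _ = ENNReal.ofReal (m * (c * V / n)) := by
          rw [← ofReal_integral_eq_lintegral_ofReal]
          · rw [integral_const_mul, integral_const_mul, integral_finsetSum _ fun a _ =>
              integrable_finsetSum _ fun a' _ => hint a a']
            congr 2
            rw [mul_div_assoc, hV, Finset.sum_div]
            congr 1
            refine Finset.sum_congr rfl fun a _ => ?_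
            rw [integral_finsetSum _ fun a' _ => hint a a', Finset.sum_div]
            refine Finset.sum_congr rfl fun a' _ => ?_
            exact (hmom a a').2.2.trans (by rw [Fintype.card_fin])
          · exact ((integrable_finsetSum _ fun a _ =>
              integrable_finsetSum _ fun a' _ => hint a a').const_mul _).const_mul _
          · exact ae_of_all _ fun g => by positivity
  refine (wasserstein2_le_of_coupling ((γ.prod ν).map fun z => (F z, F' z)) ?_ ?_).trans ?_
  · rw [Measure.map_map measurable_fst (hFm.prodMk hF'm), ← hfirst]; rfl
  · rw [Measure.map_map measurable_snd (hFm.prodMk hF'm), ← hsecond]; rfl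
  rw [lintegral_map (by fun_prop) (hFm.prodMk hF'm)]
  calc (∫⁻ z, ‖F z - F' z‖ₑ ^ 2 ∂(γ.prod ν)) ^ (1 / 2 : ℝ)
      ≤ ENNReal.ofReal (m * (c * V / n)) ^ (1 / 2 : ℝ) := by gcongr
    _ = ENNReal.ofReal √(m * (c * V / n)) := by
        rw [ENNReal.ofReal_rpow_of_nonneg (by positivity) (by norm_num), Real.sqrt_eq_rpow]
    _ ≤ ENNReal.ofReal (√m * √(c * V + 1) / √n) := by
        refine ENNReal.ofReal_le_ofReal ?_
        rw [← Real.sqrt_mul (by positivity), ← Real.sqrt_div (by positivity), ← mul_div_assoc]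
        gcongr
        linarith

/-! ### The kernel recursion -/

section Kernel

variable {d k : ℕ}

/-- The matrix `K⁽ˡ⁾[X]` of the kernel at the inputs `X`. -/
def nngpMatrix (σ : ℝ → ℝ) (cw cb : ℕ → ℝ≥0) (X : Fin k → Fin d → ℝ) (ℓ : ℕ) :
    Matrix (Fin k) (Fin k) ℝ :=
  of fun a a' => nngpKernel σ cw cb ℓ (X a) (X a')

lemma nngpLaw_eq (σ : ℝ → ℝ) (cw cb : ℕ → ℝ≥0) (X : Fin k → Fin d → ℝ) (ℓ m : ℕ) :
    nngpLaw σ cw cb X ℓ m = multivariateGaussian 0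
      ((1 : Matrix (Fin m) (Fin m) ℝ) ⊗ₖ nngpMatrix σ cw cb X ℓ) := rfl

lemma isProbabilityMeasure_nngpLaw (σ : ℝ → ℝ) (cw cb : ℕ → ℝ≥0) (X : Fin k → Fin d → ℝ)
    (ℓ m : ℕ) : IsProbabilityMeasure (nngpLaw σ cw cb X ℓ m) := by
  rw [nngpLaw_eq]; infer_instance

lemma nngpMatrix_one (σ : ℝ → ℝ) (cw cb : ℕ → ℝ≥0) (X : Fin k → Fin d → ℝ) :
    nngpMatrix σ cw cb X 1 = empiricalKernel (cw 0 / d : ℝ) (cb 0) (fun j a => X a j) := by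
  ext a a'
  simp [nngpMatrix, nngpKernel, empiricalKernel, dotProduct]

/-- The restriction of a centred Gaussian vector to two coordinates, which may coincide. -/
theorem integral_pair_multivariateGaussian {ι : Type*} [Fintype ι] [DecidableEq ι]
    {S : Matrix ι ι ℝ} (hS : S.PosSemidef) (a a' : ι) {f : ℝ → ℝ → ℝ}
    (hf : Continuous (Function.uncurry f)) :
    ∫ z, f (z 0) (z 1) ∂(multivariateGaussian (0 : EuclideanSpace ℝ (Fin 2))
        !![S a a, S a a'; S a' a, S a' a']) =
      ∫ z : EuclideanSpace ℝ ι, f (z a) (z a') ∂(multivariateGaussian 0 S) := by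
  set M : Matrix (Fin 2) ι ℝ := of ![Pi.single a 1, Pi.single a' 1] with hM
  have hMS : M * S * Mᵀ = !![S a a, S a a'; S a' a, S a' a'] := by
    ext i j
    fin_cases i <;> fin_cases j <;> simp [hM, mul_apply, Pi.single_apply]
  have hmeas := measurable_toLp_mulVec M
  have hfc : Continuous fun z : EuclideanSpace ℝ (Fin 2) => f (z 0) (z 1) :=
    hf.comp (by fun_prop : Continuous fun z : EuclideanSpace ℝ (Fin 2) => (z 0, z 1))
  rw [← hMS, ← map_multivariateGaussian_mulVec hS, integral_map hmeas.aemeasurable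
    hfc.aestronglyMeasurable]
  simp [hM]

theorem nngpMatrix_add_two {σ : ℝ → ℝ} (hσ : Continuous σ) (cw cb : ℕ → ℝ≥0)
    (X : Fin k → Fin d → ℝ) {ℓ : ℕ} (h : (nngpMatrix σ cw cb X (ℓ + 1)).PosSemidef) :
    nngpMatrix σ cw cb X (ℓ + 2) = activationKernel σ (cw (ℓ + 1)) (cb (ℓ + 1))
      (nngpMatrix σ cw cb X (ℓ + 1)) := by
  ext a a'
  have := integral_pair_multivariateGaussian h a a' (f := fun x y => σ x * σ y) (by fun_prop)
  simp only [activationKernel, of_apply, ← this]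
  rfl

theorem posSemidef_nngpMatrix {σ : ℝ → ℝ} {K : ℝ≥0} (hσ : LipschitzWith K σ) (cw cb : ℕ → ℝ≥0)
    (X : Fin k → Fin d → ℝ) (ℓ : ℕ) : (nngpMatrix σ cw cb X (ℓ + 1)).PosSemidef := by
  induction ℓ with
  | zero =>
    rw [nngpMatrix_one]
    exact posSemidef_empiricalKernel (by positivity) (by positivity) _
  | succ ℓ ih =>
    rw [nngpMatrix_add_two hσ.continuous cw cb X ih]
    exact posSemidef_activationKernel hσ (by positivity) (by positivity) _

theorem nngpKernel_congr (σ : ℝ → ℝ) {cw cb cw' cb' : ℕ → ℝ≥0} :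
    ∀ {ℓ : ℕ}, (∀ j < ℓ, cw j = cw' j) → (∀ j < ℓ, cb j = cb' j) → ∀ x y : Fin d → ℝ,
      nngpKernel σ cw cb ℓ x y = nngpKernel σ cw' cb' ℓ x y
  | 0, _, _, _, _ => rfl
  | 1, hw, hb, x, y => by simp only [nngpKernel, hw 0 one_pos, hb 0 one_pos]
  | ℓ + 2, hw, hb, x, y => by
    have ih := nngpKernel_congr σ (ℓ := ℓ + 1) (fun j hj => hw j (by omega))
      (fun j hj => hb j (by omega))
    simp only [nngpKernel, hw (ℓ + 1) (by omega), hb (ℓ + 1) (by omega), ih]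

/-- The extension by zero of finitely many variances to all layers. -/
def extendZero {L : ℕ} (v : Fin L → ℝ≥0) : ℕ → ℝ≥0 :=
  Function.extend Fin.val v 0

lemma extendZero_restrict {L : ℕ} (v : ℕ → ℝ≥0) {j : ℕ} (hj : j < L) :
    extendZero (fun j : Fin L => v j) j = v j :=
  Fin.val_injective.extend_apply (fun j : Fin L => v j) 0 ⟨j, hj⟩

/-- The constant of one layer depends on the variances of the layers below `ℓ` only: it is obtained
for their extension by zero, which defines the same kernel at the levels `≤ ℓ`. For `ℓ < 2` there
is no error and any constant will do. -/
theorem exists_wasserstein2_layerStep_nngpLaw_le {σ : ℝ → ℝ} {K : ℝ≥0} (hσ : LipschitzWith K σ)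
    (X : Fin k → Fin d → ℝ) (ℓ : ℕ) (cw cb : Fin ℓ → ℝ≥0) :
    ∃ C : ℝ, 0 < C ∧ ∀ i, i + 2 = ℓ → ∀ cw' cb' : ℕ → ℝ≥0,
      (fun j : Fin ℓ => cw' j) = cw → (fun j : Fin ℓ => cb' j) = cb → ∀ m n : ℕ, 1 ≤ n →
      wasserstein2 (layerStep (Fin m) σ (cw' (i + 1) / (n : ℝ≥0)) (cb' (i + 1))
          (nngpLaw σ cw' cb' X (i + 1) n)) (nngpLaw σ cw' cb' X (i + 2) m) ≤
        ENNReal.ofReal (√m * C / √n) := by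
  rcases Nat.lt_or_ge ℓ 2 with hℓ | hℓ
  · exact ⟨1, one_pos, fun i hi => by omega⟩
  obtain ⟨i, rfl⟩ : ∃ i, ℓ = i + 2 := ⟨ℓ - 2, by omega⟩
  set ew : ℕ → ℝ≥0 := extendZero cw with hew
  set eb : ℕ → ℝ≥0 := extendZero cb with heb
  have hps := posSemidef_nngpMatrix hσ ew eb X i
  obtain ⟨C, hC, h⟩ := exists_wasserstein2_layerStep_multivariateGaussian_le hσ (ew (i + 1))
    (eb (i + 1)) hps
  refine ⟨C, hC, fun i' hi' cw' cb' hcw hcb m n hn => ?_⟩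
  obtain rfl : i' = i := by omega
  have hw : ∀ j < i' + 2, cw' j = ew j := fun j hj => by
    rw [hew, ← hcw, extendZero_restrict cw' hj]
  have hb : ∀ j < i' + 2, cb' j = eb j := fun j hj => by
    rw [heb, ← hcb, extendZero_restrict cb' hj]
  have h1 : nngpMatrix σ cw' cb' X (i' + 1) = nngpMatrix σ ew eb X (i' + 1) := by
    ext a a'
    exact nngpKernel_congr σ (fun j hj => hw j (by omega)) (fun j hj => hb j (by omega)) _ _
  have hps' : (nngpMatrix σ cw' cb' X (i' + 1)).PosSemidef := h1 ▸ hps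
  rw [nngpLaw_eq, nngpLaw_eq, nngpMatrix_add_two hσ.continuous cw' cb' X hps', h1,
    hw (i' + 1) (by omega), hb (i' + 1) (by omega)]
  exact h m n hn

end Kernel

/-! ### The law of the network outputs -/

section Network

variable {n : ℕ → ℕ} {k : ℕ} (σ : ℝ → ℝ)

/-- The parameters of layer `ℓ` as one family, indexed as in `layerParamLaw`. -/
def layerParam (W : (ℓ : ℕ) → Matrix (Fin (n (ℓ + 1))) (Fin (n ℓ)) ℝ)
    (b : (ℓ : ℕ) → Fin (n (ℓ + 1)) → ℝ) (ℓ : ℕ) :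
    (Fin (n (ℓ + 1)) × Fin (n ℓ)) ⊕ Fin (n (ℓ + 1)) → ℝ :=
  Sum.elim (fun p => W ℓ p.1 p.2) (b ℓ)

lemma networkOutputs_one (W : (ℓ : ℕ) → Matrix (Fin (n (ℓ + 1))) (Fin (n ℓ)) ℝ)
    (b : (ℓ : ℕ) → Fin (n (ℓ + 1)) → ℝ) (X : Fin k → Fin (n 0) → ℝ) :
    networkOutputs σ W b X 1 = WithLp.toLp 2
      (layerMatrix (Fin (n 1)) (fun j a => X a j) 1 *ᵥ layerParam W b 0) := by
  ext p
  refine Eq.trans ?_ (layerMatrix_mulVec_apply _ _ _ p).symm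
  simp [networkOutputs, networkOutput, layerParam, mulVec, dotProduct]

lemma networkOutputs_add_two (W : (ℓ : ℕ) → Matrix (Fin (n (ℓ + 1))) (Fin (n ℓ)) ℝ)
    (b : (ℓ : ℕ) → Fin (n (ℓ + 1)) → ℝ) (X : Fin k → Fin (n 0) → ℝ) (ℓ : ℕ) :
    networkOutputs σ W b X (ℓ + 2) = WithLp.toLp 2 (layerMatrix (Fin (n (ℓ + 2)))
      (fun j a => σ (networkOutputs σ W b X (ℓ + 1) (j, a))) 1 *ᵥ layerParam W b (ℓ + 1)) := by
  ext p
  refine Eq.trans ?_ (layerMatrix_mulVec_apply _ _ _ p).symm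
  simp [networkOutputs, networkOutput, layerParam, mulVec, dotProduct]

lemma networkOutput_congr {W W' : (ℓ : ℕ) → Matrix (Fin (n (ℓ + 1))) (Fin (n ℓ)) ℝ}
    {b b' : (ℓ : ℕ) → Fin (n (ℓ + 1)) → ℝ} (x : Fin (n 0) → ℝ) :
    ∀ {ℓ : ℕ}, (∀ j < ℓ, W j = W' j) → (∀ j < ℓ, b j = b' j) →
      networkOutput σ W b x ℓ = networkOutput σ W' b' x ℓ
  | 0, _, _ => rfl
  | 1, hW, hb => by simp only [networkOutput, hW 0 one_pos, hb 0 one_pos]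
  | ℓ + 2, hW, hb => by
    have ih := networkOutput_congr (ℓ := ℓ + 1) x (fun j hj => hW j (by omega))
      (fun j hj => hb j (by omega))
    simp only [networkOutput, hW (ℓ + 1) (by omega), hb (ℓ + 1) (by omega), ih]

variable {σ}

lemma measurable_networkOutput {Ω : Type*} [MeasurableSpace Ω] (hσ : Measurable σ)
    {W : (ℓ : ℕ) → Ω → Matrix (Fin (n (ℓ + 1))) (Fin (n ℓ)) ℝ}
    {b : (ℓ : ℕ) → Ω → Fin (n (ℓ + 1)) → ℝ} (hW : ∀ ℓ i j, Measurable fun ω => W ℓ ω i j)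
    (hb : ∀ ℓ i, Measurable fun ω => b ℓ ω i) (x : Fin (n 0) → ℝ) :
    ∀ (ℓ : ℕ) (i : Fin (n ℓ)), Measurable fun ω =>
      networkOutput σ (fun j => W j ω) (fun j => b j ω) x ℓ i
  | 0, _ => measurable_const
  | 1, i => by
    simp only [networkOutput, Pi.add_apply, mulVec, dotProduct]
    exact (Finset.measurable_sum _ fun j _ => (hW 0 i j).mul_const _).add (hb 0 i)
  | ℓ + 2, i => by
    simp only [networkOutput, Pi.add_apply, mulVec, dotProduct]
    exact (Finset.measurable_sum _ fun j _ => (hW (ℓ + 1) i j).mul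
      (hσ.comp (measurable_networkOutput hσ hW hb x (ℓ + 1) j))).add (hb (ℓ + 1) i)

/-- The outputs at layer `ℓ` are a measurable function of the parameters of the layers below. -/
theorem exists_networkOutputs_eq_comp {Ω : Type*} (hσ : Measurable σ) {L : ℕ}
    (W : (ℓ : ℕ) → Ω → Matrix (Fin (n (ℓ + 1))) (Fin (n ℓ)) ℝ)
    (b : (ℓ : ℕ) → Ω → Fin (n (ℓ + 1)) → ℝ) (X : Fin k → Fin (n 0) → ℝ) {ℓ : ℕ} (hℓ : ℓ ≤ L) :
    ∃ φ : ((Finset.univ.filter fun p : ParamIndex n L => p.1.1 < ℓ) → ℝ) →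
        EuclideanSpace ℝ (Fin (n ℓ) × Fin k), Measurable φ ∧
      ∀ ω, networkOutputs σ (fun j => W j ω) (fun j => b j ω) X ℓ =
        φ fun p => networkParam L W b p.1 ω := by
  set W' : (j : ℕ) → ((Finset.univ.filter fun p : ParamIndex n L => p.1.1 < ℓ) → ℝ) →
      Matrix (Fin (n (j + 1))) (Fin (n j)) ℝ := fun j η => of fun i i' =>
    if h : j < ℓ then η ⟨⟨⟨j, h.trans_le hℓ⟩, .inl (i, i')⟩, by simpa using h⟩ else 0 with hW'
  set b' : (j : ℕ) → ((Finset.univ.filter fun p : ParamIndex n L => p.1.1 < ℓ) → ℝ) →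
      Fin (n (j + 1)) → ℝ := fun j η i =>
    if h : j < ℓ then η ⟨⟨⟨j, h.trans_le hℓ⟩, .inr i⟩, by simpa using h⟩ else 0 with hb'
  refine ⟨fun η => networkOutputs σ (fun j => W' j η) (fun j => b' j η) X ℓ, ?_, fun ω => ?_⟩
  · refine (WithLp.measurable_toLp 2 _).comp (measurable_pi_lambda _ fun p => ?_)
    refine measurable_networkOutput hσ (fun j i i' => ?_) (fun j i => ?_) _ _ _
    · by_cases h : j < ℓ
      · simp only [hW', of_apply, h, dif_pos]; fun_prop
      · simp only [hW', of_apply, h, dif_neg, not_false_eq_true]; fun_prop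
    · by_cases h : j < ℓ
      · simp only [hb', h, dif_pos]; fun_prop
      · simp only [hb', h, dif_neg, not_false_eq_true]; fun_prop
  · ext p
    simp only [networkOutputs]
    refine congrFun (networkOutput_congr σ _ (fun j hj => ?_) (fun j hj => ?_)) _
    · ext i i'
      simp [hW', hj, networkParam]
    · ext i
      simp [hb', hj, networkParam]

end Network

namespace IsGaussianInit

variable {Ω : Type*} [MeasurableSpace Ω] {P : Measure Ω} {n : ℕ → ℕ} {k L : ℕ}
  {cw cb : ℕ → ℝ≥0} {W : (ℓ : ℕ) → Ω → Matrix (Fin (n (ℓ + 1))) (Fin (n ℓ)) ℝ}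
  {b : (ℓ : ℕ) → Ω → Fin (n (ℓ + 1)) → ℝ} {σ : ℝ → ℝ}

lemma aemeasurable_networkParam (h : IsGaussianInit P L cw cb W b) :
    ∀ p, AEMeasurable (networkParam L W b p) P
  | ⟨ℓ, .inl (i, j)⟩ => (h.weight_law ℓ ℓ.2 i j).aemeasurable
  | ⟨ℓ, .inr i⟩ => (h.bias_law ℓ ℓ.2 i).aemeasurable

lemma aemeasurable_networkOutputs (h : IsGaussianInit P L cw cb W b) (hσ : Measurable σ)
    (X : Fin k → Fin (n 0) → ℝ) {ℓ : ℕ} (hℓ : ℓ ≤ L) :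
    AEMeasurable (fun ω => networkOutputs σ (fun j => W j ω) (fun j => b j ω) X ℓ) P := by
  obtain ⟨φ, hφ, hφe⟩ := exists_networkOutputs_eq_comp hσ W b X hℓ
  simp only [hφe]
  exact hφ.comp_aemeasurable (aemeasurable_pi_lambda _ fun p => h.aemeasurable_networkParam _)

lemma aemeasurable_layerParam (h : IsGaussianInit P L cw cb W b) {ℓ : ℕ} (hℓ : ℓ < L) :
    AEMeasurable (fun ω => layerParam (fun j => W j ω) (fun j => b j ω) ℓ) P := by
  refine aemeasurable_pi_lambda _ fun s => ?_
  cases s with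
  | inl p => exact (h.weight_law ℓ hℓ p.1 p.2).aemeasurable
  | inr i => exact (h.bias_law ℓ hℓ i).aemeasurable

lemma indepFun_networkOutputs_layerParam (h : IsGaussianInit P L cw cb W b) (hσ : Measurable σ)
    (X : Fin k → Fin (n 0) → ℝ) {ℓ : ℕ} (hℓ : ℓ < L) :
    IndepFun (fun ω => networkOutputs σ (fun j => W j ω) (fun j => b j ω) X ℓ)
      (fun ω => layerParam (fun j => W j ω) (fun j => b j ω) ℓ) P := by
  obtain ⟨φ, hφ, hφe⟩ := exists_networkOutputs_eq_comp hσ W b X hℓ.le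
  have hdisj : Disjoint (Finset.univ.filter fun p : ParamIndex n L => p.1.1 < ℓ)
      (Finset.univ.filter fun p : ParamIndex n L => p.1.1 = ℓ) :=
    Finset.disjoint_filter.2 fun p _ hp hp' => hp.ne hp'
  have h1 := h.indep.indepFun_finset₀ _ _ hdisj h.aemeasurable_networkParam
  have hψ : Measurable fun (η : (Finset.univ.filter fun p : ParamIndex n L => p.1.1 = ℓ) → ℝ)
      (s : (Fin (n (ℓ + 1)) × Fin (n ℓ)) ⊕ Fin (n (ℓ + 1))) =>
      η ⟨⟨⟨ℓ, hℓ⟩, s⟩, by simp⟩ := by fun_prop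
  convert h1.comp hφ hψ using 1
  · ext1 ω
    exact hφe ω
  · ext ω s
    cases s <;> rfl

lemma map_layerParam (h : IsGaussianInit P L cw cb W b) {ℓ : ℕ} (hℓ : ℓ < L) :
    P.map (fun ω => layerParam (fun j => W j ω) (fun j => b j ω) ℓ) =
      layerParamLaw (Fin (n (ℓ + 1))) (Fin (n ℓ)) (cw ℓ / (n ℓ : ℝ≥0)) (cb ℓ) := by
  have hinj : Function.Injective fun s => (⟨⟨ℓ, hℓ⟩, s⟩ : ParamIndex n L) :=
    fun s s' e => eq_of_heq (Sigma.mk.inj e).2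
  have h1 := (h.indep.precomp hinj).map_fun_eq_pi_map fun s => h.aemeasurable_networkParam _
  have h2 : (fun ω => layerParam (fun j => W j ω) (fun j => b j ω) ℓ) =
      fun ω s => networkParam L W b ⟨⟨ℓ, hℓ⟩, s⟩ ω := by
    ext ω s
    cases s <;> rfl
  rw [h2, layerParamLaw]
  refine h1.trans (congrArg Measure.pi (funext fun s => ?_))
  cases s with
  | inl p => exact (h.weight_law ℓ hℓ p.1 p.2).map_eq
  | inr i => exact (h.bias_law ℓ hℓ i).map_eq

theorem map_networkOutputs_one (h : IsGaussianInit P L cw cb W b) (hL : 1 ≤ L)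
    (X : Fin k → Fin (n 0) → ℝ) :
    P.map (fun ω => networkOutputs σ (fun j => W j ω) (fun j => b j ω) X 1) =
      nngpLaw σ cw cb X 1 (n 1) := by
  have hm : Measurable fun θ : (Fin (n 1) × Fin (n 0)) ⊕ Fin (n 1) → ℝ =>
      WithLp.toLp 2 (layerMatrix (Fin (n 1)) (fun j a => X a j) 1 *ᵥ θ) :=
    measurable_layerMatrix_mulVec (u := fun _ j a => X a j) (fun _ _ => measurable_const)
      measurable_id 1
  simp only [networkOutputs_one]
  have h1 := AEMeasurable.map_map_of_aemeasurable hm.aemeasurable (h.aemeasurable_layerParam hL)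
  simp only [Function.comp_def] at h1
  rw [← h1, h.map_layerParam hL, map_layerParamLaw, nngpLaw_eq, nngpMatrix_one]
  simp

theorem map_networkOutputs_add_two [IsProbabilityMeasure P] (h : IsGaussianInit P L cw cb W b)
    (hσ : Measurable σ) (X : Fin k → Fin (n 0) → ℝ) {ℓ : ℕ} (hℓ : ℓ + 2 ≤ L) :
    P.map (fun ω => networkOutputs σ (fun j => W j ω) (fun j => b j ω) X (ℓ + 2)) =
      layerStep (Fin (n (ℓ + 2))) σ (cw (ℓ + 1) / (n (ℓ + 1) : ℝ≥0)) (cb (ℓ + 1))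
        (P.map fun ω => networkOutputs σ (fun j => W j ω) (fun j => b j ω) X (ℓ + 1)) := by
  have hf := h.aemeasurable_networkOutputs hσ X (ℓ := ℓ + 1) (by omega)
  have hθ := h.aemeasurable_layerParam (ℓ := ℓ + 1) (by omega)
  have hind := (indepFun_iff_map_prod_eq_prod_map_map hf hθ).1
    (h.indepFun_networkOutputs_layerParam hσ X (by omega))
  have hL := measurable_layerStep_map (m := Fin (n (ℓ + 2))) (n := Fin (n (ℓ + 1))) (k := Fin k) hσ
  rw [layerStep, ← h.map_layerParam (ℓ := ℓ + 1) (by omega), ← hind,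
    AEMeasurable.map_map_of_aemeasurable hL.aemeasurable (hf.prodMk hθ)]
  simp only [networkOutputs_add_two]
  rfl

end IsGaussianInit

/-! ### Propagation of the error through the layers -/

/-- Induction over the layers: the error of the previous layer is multiplied by the Lipschitz
constant of a random layer, and the error of that layer on Gaussian inputs is added. -/
theorem IsGaussianInit.wasserstein2_networkOutputs_le {Ω : Type*} [MeasurableSpace Ω]
    {P : Measure Ω} [IsProbabilityMeasure P] {n : ℕ → ℕ} {k L : ℕ} {cw cb : ℕ → ℝ≥0}
    {W : (ℓ : ℕ) → Ω → Matrix (Fin (n (ℓ + 1))) (Fin (n ℓ)) ℝ}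
    {b : (ℓ : ℕ) → Ω → Fin (n (ℓ + 1)) → ℝ} {σ : ℝ → ℝ} {K : ℝ≥0}
    (h : IsGaussianInit P L cw cb W b) (hσ : LipschitzWith K σ)
    (hn : ∀ ℓ, 1 ≤ ℓ → ℓ ≤ L → 1 ≤ n ℓ) (X : Fin k → Fin (n 0) → ℝ) {c : ℕ → ℝ}
    (hc0 : ∀ i, 0 ≤ c i)
    (hc : ∀ i m N : ℕ, 1 ≤ N → wasserstein2
      (layerStep (Fin m) σ (cw (i + 1) / (N : ℝ≥0)) (cb (i + 1)) (nngpLaw σ cw cb X (i + 1) N))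
      (nngpLaw σ cw cb X (i + 2) m) ≤ ENNReal.ofReal (√m * c (i + 2) / √N)) :
    ∀ ℓ, ℓ + 1 ≤ L → wasserstein2
      (P.map fun ω => networkOutputs σ (fun j => W j ω) (fun j => b j ω) X (ℓ + 1))
      (nngpLaw σ cw cb X (ℓ + 1) (n (ℓ + 1))) ≤
      ENNReal.ofReal (√(n (ℓ + 1) : ℝ) * ∑ i ∈ Finset.Ico 1 (ℓ + 1),
        c (i + 1) * (K : ℝ) ^ (ℓ + 1 - i - 1) *
          √(∏ j ∈ Finset.Ico (i + 1) (ℓ + 1), (cw j : ℝ)) / √(n i : ℝ)) := by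
  intro ℓ
  induction ℓ with
  | zero =>
    intro hL
    rw [h.map_networkOutputs_one hL, wasserstein2_self]
    exact zero_le
  | succ ℓ ih =>
    intro hL
    have hσm : Measurable σ := hσ.continuous.measurable
    have hN : 1 ≤ n (ℓ + 1) := hn _ (by omega) (by omega)
    have hN0 : (0 : ℝ) < n (ℓ + 1) := by exact_mod_cast hN
    have hp : IsProbabilityMeasure
        (P.map fun ω => networkOutputs σ (fun j => W j ω) (fun j => b j ω) X (ℓ + 1)) :=
      Measure.isProbabilityMeasure_map (h.aemeasurable_networkOutputs hσm X (by omega))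
    have hq := isProbabilityMeasure_nngpLaw σ cw cb X (ℓ + 1) (n (ℓ + 1))
    rw [h.map_networkOutputs_add_two hσm X hL]
    set p := P.map fun ω => networkOutputs σ (fun j => W j ω) (fun j => b j ω) X (ℓ + 1)
    set w : ℝ≥0 := cw (ℓ + 1) / (n (ℓ + 1) : ℝ≥0) with hw
    have hp' := isProbabilityMeasure_layerStep (m := Fin (n (ℓ + 2))) hσm w (cb (ℓ + 1)) p
    have hq' := isProbabilityMeasure_layerStep (m := Fin (n (ℓ + 2))) hσm w (cb (ℓ + 1))
      (nngpLaw σ cw cb X (ℓ + 1) (n (ℓ + 1)))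
    set T : ℝ := ∑ i ∈ Finset.Ico 1 (ℓ + 1), c (i + 1) * (K : ℝ) ^ (ℓ + 1 - i - 1) *
          √(∏ j ∈ Finset.Ico (i + 1) (ℓ + 1), (cw j : ℝ)) / √(n i : ℝ) with hT
    have hT0 : 0 ≤ T := Finset.sum_nonneg fun i _ => by
      have := hc0 (i + 1)
      positivity
    have hsum : ∑ i ∈ Finset.Ico 1 (ℓ + 1 + 1), c (i + 1) * (K : ℝ) ^ (ℓ + 1 + 1 - i - 1) *
          √(∏ j ∈ Finset.Ico (i + 1) (ℓ + 1 + 1), (cw j : ℝ)) / √(n i : ℝ) =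
        √(cw (ℓ + 1) : ℝ) * K * T + c (ℓ + 2) / √(n (ℓ + 1) : ℝ) := by
      rw [Finset.sum_Ico_succ_top (by omega), hT, Finset.mul_sum]
      congr 1
      · refine Finset.sum_congr rfl fun i hi => ?_
        have hi' := Finset.mem_Ico.1 hi
        rw [Finset.prod_Ico_succ_top (by omega), Real.sqrt_mul
          (Finset.prod_nonneg fun _ _ => NNReal.coe_nonneg _),
          show ℓ + 1 + 1 - i - 1 = (ℓ + 1 - i - 1) + 1 by omega, pow_succ]
        ring
      · simp
    have hc2 := hc ℓ (n (ℓ + 2)) (n (ℓ + 1)) hN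
    have hC2 := hc0 (ℓ + 2)
    calc wasserstein2 (layerStep (Fin (n (ℓ + 2))) σ w (cb (ℓ + 1)) p)
          (nngpLaw σ cw cb X (ℓ + 1 + 1) (n (ℓ + 1 + 1)))
        ≤ wasserstein2 (layerStep (Fin (n (ℓ + 2))) σ w (cb (ℓ + 1)) p)
            (layerStep (Fin (n (ℓ + 2))) σ w (cb (ℓ + 1))
              (nngpLaw σ cw cb X (ℓ + 1) (n (ℓ + 1)))) +
          wasserstein2 (layerStep (Fin (n (ℓ + 2))) σ w (cb (ℓ + 1))
              (nngpLaw σ cw cb X (ℓ + 1) (n (ℓ + 1))))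
            (nngpLaw σ cw cb X (ℓ + 2) (n (ℓ + 2))) := wasserstein2_triangle _ _ _
      _ ≤ ENNReal.ofReal (√(n (ℓ + 2) * w) * K) * ENNReal.ofReal (√(n (ℓ + 1) : ℝ) * T) +
          ENNReal.ofReal (√(n (ℓ + 2) : ℝ) * c (ℓ + 2) / √(n (ℓ + 1) : ℝ)) := by
        refine add_le_add ((wasserstein2_layerStep_le hσ w _ _ _).trans ?_) hc2
        rw [Fintype.card_fin]
        exact mul_le_mul_right (ih (by omega)) _
      _ = _ := by
        rw [hsum, ← ENNReal.ofReal_mul (by positivity), ← ENNReal.ofReal_add (by positivity)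
          (by positivity)]
        congr 1
        have h1 : √(n (ℓ + 2) * w : ℝ) * √(n (ℓ + 1) : ℝ) = √(n (ℓ + 2) : ℝ) * √(cw (ℓ + 1)) := by
          rw [← Real.sqrt_mul (by positivity), ← Real.sqrt_mul (by positivity), hw]
          congr 1
          push_cast
          field_simp
        calc √(n (ℓ + 2) * w : ℝ) * K * (√(n (ℓ + 1) : ℝ) * T) +
              √(n (ℓ + 2) : ℝ) * c (ℓ + 2) / √(n (ℓ + 1) : ℝ)
            = √(n (ℓ + 2) * w : ℝ) * √(n (ℓ + 1) : ℝ) * K * T +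
              √(n (ℓ + 2) : ℝ) * c (ℓ + 2) / √(n (ℓ + 1) : ℝ) := by ring
          _ = _ := by rw [h1]; ring

section Rates

variable {σ : ℝ → ℝ} {n₀ k : ℕ} {X : Fin k → Fin n₀ → ℝ}

/-- For `ℓ ≥ 1`, `c (ℓ + 1)` is a constant `C` for which the layer from level `ℓ` to level `ℓ + 1`,
applied to the Gaussian process, is at distance at most `√m C / √N` from the process at level
`ℓ + 1`, where `N` and `m` are the sizes of the two levels. It is a function of the variances of
the layers `0, …, ℓ`. -/
structure IsLayerRate (σ : ℝ → ℝ) (X : Fin k → Fin n₀ → ℝ)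
    (c : (ℓ : ℕ) → (Fin ℓ → ℝ≥0) → (Fin ℓ → ℝ≥0) → ℝ) : Prop where
  pos : ∀ ℓ cw cb, 0 < c ℓ cw cb
  step_le : ∀ (cw cb : ℕ → ℝ≥0) (i m N : ℕ), 1 ≤ N → wasserstein2
    (layerStep (Fin m) σ (cw (i + 1) / (N : ℝ≥0)) (cb (i + 1)) (nngpLaw σ cw cb X (i + 1) N))
    (nngpLaw σ cw cb X (i + 2) m) ≤
      ENNReal.ofReal (√m * c (i + 2) (fun j => cw j) (fun j => cb j) / √N)

theorem exists_isLayerRate (hσ : ∃ K : ℝ≥0, LipschitzWith K σ) (X : Fin k → Fin n₀ → ℝ) :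
    ∃ c, IsLayerRate σ X c := by
  obtain ⟨K, hK⟩ := hσ
  choose c hc0 hc using fun (ℓ : ℕ) (cw cb : Fin ℓ → ℝ≥0) =>
    exists_wasserstein2_layerStep_nngpLaw_le hK X ℓ cw cb
  exact ⟨c, hc0, fun cw cb i m N hN => hc (i + 2) _ _ i rfl cw cb rfl rfl m N hN⟩

variable {c : (ℓ : ℕ) → (Fin ℓ → ℝ≥0) → (Fin ℓ → ℝ≥0) → ℝ} {Ω : Type*} [MeasurableSpace Ω]
  {P : Measure Ω} [IsProbabilityMeasure P] {L : ℕ} {n : ℕ → ℕ} {cw cb : ℕ → ℝ≥0}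
  {W : (ℓ : ℕ) → Ω → Matrix (Fin (layerSize n₀ n (ℓ + 1))) (Fin (layerSize n₀ n ℓ)) ℝ}
  {b : (ℓ : ℕ) → Ω → Fin (layerSize n₀ n (ℓ + 1)) → ℝ}

theorem IsLayerRate.wasserstein2_le (hc : IsLayerRate σ X c)
    (hn : ∀ ℓ, 1 ≤ ℓ → ℓ ≤ L → 1 ≤ n ℓ) (h : IsGaussianInit P L cw cb W b) {K : ℝ≥0}
    (hK : LipschitzWith K σ) {ℓ : ℕ} (hℓ : 1 ≤ ℓ) (hℓL : ℓ ≤ L) :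
    wasserstein2 (P.map fun ω => networkOutputs σ (fun j => W j ω) (fun j => b j ω) X ℓ)
        (nngpLaw σ cw cb X ℓ (layerSize n₀ n ℓ)) ≤
      ENNReal.ofReal (√(n ℓ : ℝ) * ∑ i ∈ Finset.Ico 1 ℓ,
        c (i + 1) (fun j => cw j) (fun j => cb j) * (K : ℝ) ^ (ℓ - i - 1) *
          √(∏ j ∈ Finset.Ico (i + 1) ℓ, (cw j : ℝ)) / √(n i : ℝ)) := by
  obtain ⟨l, rfl⟩ : ∃ l, ℓ = l + 1 := ⟨ℓ - 1, by omega⟩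
  have hn' : ∀ ℓ, 1 ≤ ℓ → ℓ ≤ L → 1 ≤ layerSize n₀ n ℓ := by
    rintro (_ | ℓ) h1 h2
    · omega
    · exact hn _ h1 h2
  refine (h.wasserstein2_networkOutputs_le hK hn' X
    (c := fun i => c i (fun j => cw j) (fun j => cb j)) (fun i => (hc.pos _ _ _).le)
    (hc.step_le cw cb) l hℓL).trans (le_of_eq ?_)
  congr 2
  refine Finset.sum_congr rfl fun i hi => ?_
  obtain ⟨i', rfl⟩ : ∃ i', i = i' + 1 := ⟨i - 1, by have := Finset.mem_Ico.1 hi; omega⟩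
  rfl

/-- A constant for the output of a network with `L` layers: every coefficient of
`√(n L) / √(n i)` in the precise bound is at most `depthConstant c K L cw cb`. -/
def depthConstant (c : (ℓ : ℕ) → (Fin ℓ → ℝ≥0) → (Fin ℓ → ℝ≥0) → ℝ) (K : ℝ≥0) (L : ℕ)
    (cw cb : Fin L → ℝ≥0) : ℝ :=
  1 + ∑ i ∈ Finset.Ico 1 L,
    c (i + 1) (fun j => extendZero cw j) (fun j => extendZero cb j) *
      (K : ℝ) ^ (L - i - 1) * √(∏ j ∈ Finset.Ico (i + 1) L, (extendZero cw j : ℝ))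

lemma IsLayerRate.depthConstant_pos (hc : IsLayerRate σ X c) (K : ℝ≥0) (L : ℕ)
    (cw cb : Fin L → ℝ≥0) : 0 < depthConstant c K L cw cb :=
  add_pos_of_pos_of_nonneg one_pos <| Finset.sum_nonneg fun i _ => by
    have := hc.pos (i + 1) (fun j => extendZero cw j)
      (fun j => extendZero cb j)
    positivity

theorem IsLayerRate.wasserstein2_le_depthConstant (hc : IsLayerRate σ X c) {K : ℝ≥0}
    (hK : LipschitzWith K σ) (hL : 1 ≤ L) (hn : ∀ ℓ, 1 ≤ ℓ → ℓ ≤ L → 1 ≤ n ℓ)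
    (h : IsGaussianInit P L cw cb W b) :
    wasserstein2 (P.map fun ω => networkOutputs σ (fun j => W j ω) (fun j => b j ω) X L)
        (nngpLaw σ cw cb X L (layerSize n₀ n L)) ≤
      ENNReal.ofReal (depthConstant c K L (fun j => cw j) (fun j => cb j) * √(n L : ℝ) *
        ∑ ℓ ∈ Finset.Ico 1 L, 1 / √(n ℓ : ℝ)) := by
  refine (hc.wasserstein2_le hn h hK hL le_rfl).trans (ENNReal.ofReal_le_ofReal ?_)
  set t : ℕ → ℝ := fun i => c (i + 1) (fun j => cw j) (fun j => cb j) * (K : ℝ) ^ (L - i - 1) *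
    √(∏ j ∈ Finset.Ico (i + 1) L, (cw j : ℝ)) with ht
  have hC : depthConstant c K L (fun j => cw j) (fun j => cb j) =
      1 + ∑ i ∈ Finset.Ico 1 L, t i := by
    rw [depthConstant]
    congr 1
    refine Finset.sum_congr rfl fun i hi => ?_
    have hi' := (Finset.mem_Ico.1 hi).2
    have hp : ∏ j ∈ Finset.Ico (i + 1) L,
        (extendZero (fun j : Fin L => cw j) j : ℝ) =
        ∏ j ∈ Finset.Ico (i + 1) L, (cw j : ℝ) :=
      Finset.prod_congr rfl fun j hj => by rw [extendZero_restrict cw (Finset.mem_Ico.1 hj).2]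
    have h1 : ∀ v : ℕ → ℝ≥0, (fun j : Fin (i + 1) =>
        extendZero (fun j : Fin L => v j) j) = fun j : Fin (i + 1) => v j := fun v =>
      funext fun j => extendZero_restrict v (by omega)
    rw [hp, h1, h1]
  have ht0 : ∀ i, 0 ≤ t i := fun i => by
    have := hc.pos (i + 1) (fun j => cw j) (fun j => cb j)
    positivity
  rw [hC, mul_comm _ √(n L : ℝ), mul_assoc]
  refine mul_le_mul_of_nonneg_left ?_ (Real.sqrt_nonneg _)
  rw [Finset.mul_sum]
  refine Finset.sum_le_sum fun i hi => ?_
  have hti : t i ≤ 1 + ∑ i ∈ Finset.Ico 1 L, t i :=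
    (Finset.single_le_sum (fun i _ => ht0 i) hi).trans (le_add_of_nonneg_left zero_le_one)
  rw [mul_one_div]
  exact div_le_div_of_nonneg_right hti (Real.sqrt_nonneg _)

lemma exists_nat_mul_sum_inv_sqrt_le (B : ℝ) (L : ℕ) {r : ℝ} (hr : 0 < r) :
    ∃ N : ℕ, 1 ≤ N ∧ ∀ n : ℕ → ℕ, (∀ ℓ, 1 ≤ ℓ → ℓ < L → N ≤ n ℓ) →
      B * ∑ ℓ ∈ Finset.Ico 1 L, 1 / √(n ℓ : ℝ) ≤ r := by
  obtain ⟨N, hN⟩ := exists_nat_ge ((|B| * L / r) ^ 2)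
  refine ⟨N + 1, by omega, fun n hn => ?_⟩
  have hN0 : (0 : ℝ) < √((N + 1 : ℕ) : ℝ) := Real.sqrt_pos.2 (by positivity)
  have hsum : ∑ ℓ ∈ Finset.Ico 1 L, 1 / √(n ℓ : ℝ) ≤ L * (1 / √((N + 1 : ℕ) : ℝ)) := by
    calc ∑ ℓ ∈ Finset.Ico 1 L, 1 / √(n ℓ : ℝ)
        ≤ ∑ ℓ ∈ Finset.Ico 1 L, 1 / √((N + 1 : ℕ) : ℝ) := by
          refine Finset.sum_le_sum fun ℓ hℓ => ?_
          have hℓ' := Finset.mem_Ico.1 hℓ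
          exact one_div_le_one_div_of_le hN0
            (Real.sqrt_le_sqrt (by exact_mod_cast hn ℓ hℓ'.1 hℓ'.2))
      _ ≤ L * (1 / √((N + 1 : ℕ) : ℝ)) := by
          rw [Finset.sum_const, nsmul_eq_mul, Nat.card_Ico]
          refine mul_le_mul_of_nonneg_right ?_ (by positivity)
          exact_mod_cast Nat.sub_le L 1
  have hroot : |B| * L / r ≤ √((N + 1 : ℕ) : ℝ) := by
    refine Real.le_sqrt_of_sq_le (hN.trans ?_)
    push_cast
    linarith
  calc B * ∑ ℓ ∈ Finset.Ico 1 L, 1 / √(n ℓ : ℝ)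
      ≤ |B| * (L * (1 / √((N + 1 : ℕ) : ℝ))) :=
        mul_le_mul (le_abs_self B) hsum (Finset.sum_nonneg fun _ _ => by positivity) (abs_nonneg B)
    _ = |B| * L / √((N + 1 : ℕ) : ℝ) := by ring
    _ ≤ r := by
        rw [div_le_iff₀ hN0]
        rwa [div_le_iff₀ hr, mul_comm _ r] at hroot

end Rates

end

theorem theorem3p1 (σ : ℝ → ℝ) (hσ : ∃ K : ℝ≥0, LipschitzWith K σ)
    (n₀ k : ℕ) (hn₀ : 1 ≤ n₀) (X : Fin k → Fin n₀ → ℝ) :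
    -- the precise bound; `C ℓ` only sees `σ`, `X` and the variances of the layers below `ℓ`
    (∃ C : (ℓ : ℕ) → (Fin ℓ → ℝ≥0) → (Fin ℓ → ℝ≥0) → ℝ,
      (∀ ℓ cw cb, 0 < C ℓ cw cb) ∧
      ∀ (L : ℕ) (n : ℕ → ℕ), (∀ ℓ, 1 ≤ ℓ → ℓ ≤ L → 1 ≤ n ℓ) →
      ∀ (cw cb : ℕ → ℝ≥0) {Ω : Type*} [MeasurableSpace Ω] (P : Measure Ω)
        [IsProbabilityMeasure P]
        (W : (ℓ : ℕ) → Ω →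
          Matrix (Fin (layerSize n₀ n (ℓ + 1))) (Fin (layerSize n₀ n ℓ)) ℝ)
        (b : (ℓ : ℕ) → Ω → Fin (layerSize n₀ n (ℓ + 1)) → ℝ),
      IsGaussianInit P L cw cb W b →
      ∀ K : ℝ≥0, LipschitzWith K σ →
      ∀ ℓ, 1 ≤ ℓ → ℓ ≤ L →
        wasserstein2
          (P.map fun ω => networkOutputs σ (fun j => W j ω) (fun j => b j ω) X ℓ)
          (nngpLaw σ cw cb X ℓ (layerSize n₀ n ℓ)) ≤
        ENNReal.ofReal (√(n ℓ : ℝ) * ∑ i ∈ Finset.Ico 1 ℓ,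
          C (i + 1) (fun j => cw j) (fun j => cb j) * (K : ℝ) ^ (ℓ - i - 1) *
            √(∏ j ∈ Finset.Ico (i + 1) ℓ, (cw j : ℝ)) / √(n i : ℝ))) ∧
    -- the simplified bound for the output layer
    (∃ C : (L : ℕ) → (Fin L → ℝ≥0) → (Fin L → ℝ≥0) → ℝ,
      (∀ L cw cb, 0 < C L cw cb) ∧
      ∀ (L : ℕ), 1 ≤ L → ∀ (n : ℕ → ℕ), (∀ ℓ, 1 ≤ ℓ → ℓ ≤ L → 1 ≤ n ℓ) →
      ∀ (cw cb : ℕ → ℝ≥0) {Ω : Type*} [MeasurableSpace Ω] (P : Measure Ω)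
        [IsProbabilityMeasure P]
        (W : (ℓ : ℕ) → Ω →
          Matrix (Fin (layerSize n₀ n (ℓ + 1))) (Fin (layerSize n₀ n ℓ)) ℝ)
        (b : (ℓ : ℕ) → Ω → Fin (layerSize n₀ n (ℓ + 1)) → ℝ),
      IsGaussianInit P L cw cb W b →
        wasserstein2
          (P.map fun ω => networkOutputs σ (fun j => W j ω) (fun j => b j ω) X L)
          (nngpLaw σ cw cb X L (layerSize n₀ n L)) ≤
        ENNReal.ofReal (C L (fun j => cw j) (fun j => cb j) * √(n L : ℝ) *
          ∑ ℓ ∈ Finset.Ico 1 L, 1 / √(n ℓ : ℝ))) ∧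
    -- the wide limit: all hidden layers large, input and output size fixed
    (∀ (L : ℕ), 1 ≤ L → ∀ (m : ℕ), 1 ≤ m → ∀ (cw cb : ℕ → ℝ≥0) (ε : ℝ≥0∞), 0 < ε →
      ∃ N : ℕ, 1 ≤ N ∧ ∀ (n : ℕ → ℕ), (∀ ℓ, 1 ≤ ℓ → ℓ < L → N ≤ n ℓ) → n L = m →
      ∀ {Ω : Type*} [MeasurableSpace Ω] (P : Measure Ω) [IsProbabilityMeasure P]
        (W : (ℓ : ℕ) → Ω →
          Matrix (Fin (layerSize n₀ n (ℓ + 1))) (Fin (layerSize n₀ n ℓ)) ℝ)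
        (b : (ℓ : ℕ) → Ω → Fin (layerSize n₀ n (ℓ + 1)) → ℝ),
      IsGaussianInit P L cw cb W b →
        wasserstein2
          (P.map fun ω => networkOutputs σ (fun j => W j ω) (fun j => b j ω) X L)
          (nngpLaw σ cw cb X L (layerSize n₀ n L)) < ε) := by
  obtain ⟨K, hK⟩ := hσ
  obtain ⟨c, hc⟩ := exists_isLayerRate ⟨K, hK⟩ X
  refine ⟨⟨c, hc.pos, ?_⟩, ⟨depthConstant c K, hc.depthConstant_pos K, ?_⟩, ?_⟩
  · intro L n hn cw cb Ω _ P _ W b h K' hK' ℓ hℓ hℓL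
    exact hc.wasserstein2_le hn h hK' hℓ hℓL
  · intro L hL n hn cw cb Ω _ P _ W b h
    exact hc.wasserstein2_le_depthConstant hK hL hn h
  · intro L hL m hm cw cb ε hε
    obtain ⟨r, hr, hrε⟩ := ENNReal.lt_iff_exists_nnreal_btwn.1 hε
    obtain ⟨N, hN, hNn⟩ := exists_nat_mul_sum_inv_sqrt_le
      (depthConstant c K L (fun j => cw j) (fun j => cb j) * √(m : ℝ)) L
      (show (0 : ℝ) < r by exact_mod_cast hr)
    refine ⟨N, hN, fun n hn hnL Ω _ P _ W b h => ?_⟩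
    have hn1 : ∀ ℓ, 1 ≤ ℓ → ℓ ≤ L → 1 ≤ n ℓ := fun ℓ h1 h2 => by
      rcases h2.lt_or_eq with h3 | rfl
      · exact hN.trans (hn ℓ h1 h3)
      · exact hnL ▸ hm
    refine (hc.wasserstein2_le_depthConstant hK hL hn1 h).trans_lt (lt_of_le_of_lt ?_ hrε)
    rw [← ENNReal.ofReal_coe_nnreal]
    refine ENNReal.ofReal_le_ofReal ?_
    rw [hnL]
    exact hNn n hn
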